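/- **Theorem.** Let $E$ be a countable set, let $\ell^2(E)$ be the complex Hilbert space with inner product $(f,g)=\sum_{x\in E}\overline{f(x)}g(x)$ and canonical basis $(e_x)_{x\in E}$, and for a bounded operator $T$ on $\ell^2(E)$ write $T(x,y)=(e_x,Te_y)$. Let $A$ be a bounded Hermitian positive operator on $\ell^2(E)$ satisfying (H) (i) $\ker A=\{0\}$; (ii) $\ell^2(E)$ with the inner product $(f,g)_-:=(f,Ag)$ has a functional completion, i.e. there is a Hilbert space of complex functions on $E$, with continuous point evaluations $f\mapsto f(y)$, $y\in E$, that contains $\ell^2(E)$ as a dense subspace and whose inner product extends $(\cdot,\cdot)_-$. Let $\mathcal X$ be the set of all subsets (configurations) of $E$, with the product $\sigma$-algebra of $\{0,1\}^E$, and write $\xi_\Delta=\xi\cap\Delta$. Put, for finite $\xi\subset E$, $$V(\xi)=-\log\det(A(x,y))_{x,y\in\xi}\qquad(V(\emptyset)=0),$$ and, for disjoint finite $\zeta,\eta\subset E$, $W(\zeta;\eta)=V(\zeta\cup\eta)-V(\zeta)-V(\eta)$. Then: 1. For all finite $\Lambda\subset E$, $\zeta\subset\Lambda$ and all $\xi\in\mathcal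 X$, the limit over finite sets $\Delta$ increasing to $E$ $$H_\Lambda(\zeta;\xi)=\lim_{\Delta\uparrow E}\bigl(V(\zeta)+W(\zeta;\xi_{\Delta\setminus\Lambda})\bigr)$$ exists and is finite. Let $\gamma_\Lambda$ be the Gibbsian specification $$\gamma_\Lambda(B\mid\xi)=\frac{1}{Z_\Lambda(\xi)}\sum_{\zeta\subset\Lambda}e^{-H_\Lambda(\zeta;\xi)}\,1_B(\zeta\cup\xi_{E\setminus\Lambda}),\qquad Z_\Lambda(\xi)=\sum_{\zeta\subset\Lambda}e^{-H_\Lambda(\zeta;\xi)},$$ for measurable $B\subset\mathcal X$. A probability measure $\nu$ on $\mathcal X$ is called a Gibbs measure for $V$ if it satisfies the DLR equations $\nu(B)=\int\gamma_\Lambda(B\mid\xi)\,d\nu(\xi)$ for all finite $\Lambda\subset E$ and all measurable $B\subset\mathcal X$. 2. The determinantal point process $\mu$ of $K=A(I+A)^{-1}$, that is, the (existing and unique) probability measure on $\mathcal X$ with $\mu\{\xi:\xi\supset X\}=\det(K(x,y))_{x,y\in X}$ for all finite $X\subset E$, is a Gibbs measure for $V$. 3. $\mu$ is the only Gibbs measure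 for $V$. -/

import Mathlib

namespace DPPGibbs

universe u

noncomputable section

/-- The complex Hilbert space `ℓ²(E)`; its inner product is conjugate linear in the first slot. -/
abbrev L2 (E : Type u) : Type u := lp (fun _ : E => ℂ) 2

open Classical in
/-- The basis vector `e_x` of `ℓ²(E)`. -/
def basisVec {E : Type u} (x : E) : L2 E := lp.single 2 x (1 : ℂ)

/-- The matrix element `T(x,y) = (e_x, T e_y)` of a bounded operator on `ℓ²(E)`. -/
def matElem {E : Type u} (T : L2 E →L[ℂ] L2 E) (x y : E) : ℂ :=
  inner ℂ (basisVec x) (T (basisVec y))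

open Classical in
/-- The determinant of the finite submatrix `(T(x,y))_{x,y ∈ X}` (equal to `1` for `X = ∅`). -/
def subDet {E : Type u} (T : L2 E →L[ℂ] L2 E) (X : Finset E) : ℂ :=
  (Matrix.of fun x y : X => matElem T x y).det

/-- The pre-Hilbert space `ℓ²(E)` with inner product `(f,g)₋ = (f, A g)` admits a functional
completion: there is a Hilbert space `H` of functions on `E` with continuous point evaluations
(the class `RKHS`) which contains `ℓ²(E)`, as a class of functions, densely and with
`(f,g)_H = (f, A g)` for `f, g ∈ ℓ²(E)`. -/
def IsFunctionallyCompleted {E : Type u} (A : L2 E →L[ℂ] L2 E) : Prop :=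
  ∃ (H : Type u) (_ : NormedAddCommGroup H) (_ : InnerProductSpace ℂ H) (_ : CompleteSpace H)
    (_ : RKHS ℂ H E ℂ) (J : L2 E →ₗ[ℂ] H),
    (∀ (f : L2 E) (x : E), (J f) x = f x) ∧
    (∀ f g : L2 E, inner ℂ (J f) (J g) = inner ℂ f (A g)) ∧
    DenseRange J

/-- Hypothesis (H): `A` is a bounded Hermitian positive operator on `ℓ²(E)` with trivial kernel,
and the completion of `ℓ²(E)` for `(f,g)₋ = (f, A g)` is a functional completion. -/
structure HypH {E : Type u} (A : L2 E →L[ℂ] L2 E) : Prop where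
  isPositive : A.IsPositive
  ker_eq_bot : LinearMap.ker A.toLinearMap = ⊥
  functionallyCompleted : IsFunctionallyCompleted A

/-- The operator `A (I + A)⁻¹`. For positive `A` the operator `I + A` is invertible, so that
`Ring.inverse` is its bounded inverse. -/
def dppOperator {E : Type u} (A : L2 E →L[ℂ] L2 E) : L2 E →L[ℂ] L2 E :=
  A * Ring.inverse (1 + A)

/-- `μ` is the determinantal point process of `K`: a probability measure on the space `Set E` of
configurations (with the product `σ`-algebra of `{0,1}^E`) whose correlation functions are
`μ {ξ | X ⊆ ξ} = det (K(x,y))_{x,y ∈ X}`, `X` finite. -/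
def IsDPP {E : Type u} (K : L2 E →L[ℂ] L2 E) (μ : MeasureTheory.Measure (Set E)) : Prop :=
  MeasureTheory.IsProbabilityMeasure μ ∧
    ∀ X : Finset E, ((μ.real {ξ : Set E | (X : Set E) ⊆ ξ} : ℝ) : ℂ) = subDet K X

/-- The potential energy `V(ξ) = - log det (A(x,y))_{x,y ∈ ξ}` of a finite configuration. (The
determinant of a Hermitian matrix is real; `re` only changes the type.) -/
def detPotential {E : Type u} (A : L2 E →L[ℂ] L2 E) (ξ : Finset E) : ℝ :=
  -Real.log (subDet A ξ).re

open Classical in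
/-- The mutual potential energy `W(ζ; η)` of finite configurations on disjoint sets, defined by
`V(ζ ∪ η) = V(ζ) + V(η) + W(ζ; η)`. -/
def mutualEnergy {E : Type u} (V : Finset E → ℝ) (ζ η : Finset E) : ℝ :=
  V (ζ ∪ η) - V ζ - V η

open Classical in
/-- `V(ζ) + W(ζ; ξ_{Δ \ Λ})`, the energy of `ζ` in `Λ` with boundary condition `ξ` seen inside
the finite set `Δ`. -/
def localEnergy {E : Type u} (V : Finset E → ℝ) (Λ ζ : Finset E) (ξ : Set E) (Δ : Finset E) : ℝ :=
  V ζ + mutualEnergy V ζ ((Δ \ Λ).filter (fun x => x ∈ ξ))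

/-- The energy `H_Λ(ζ; ξ) = lim_{Δ ↑ E} (V(ζ) + W(ζ; ξ_{Δ \ Λ}))`, the limit being along the
directed set of finite subsets `Δ` of `E` (meaningful when the limit exists). -/
def energy {E : Type u} (V : Finset E → ℝ) (Λ ζ : Finset E) (ξ : Set E) : ℝ :=
  Filter.limUnder Filter.atTop (localEnergy V Λ ζ ξ)

/-- All energies `H_Λ(ζ; ξ)` are well defined: the limits exist as finite real numbers. -/
def EnergiesExist {E : Type u} (V : Finset E → ℝ) : Prop :=
  ∀ (Λ ζ : Finset E) (ξ : Set E), ζ ⊆ Λ →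
    ∃ h : ℝ, Filter.Tendsto (localEnergy V Λ ζ ξ) Filter.atTop (nhds h)

/-- The partition function `Z_Λ(ξ) = ∑_{ζ ⊆ Λ} exp (- H_Λ(ζ; ξ))`. -/
def partitionFunction {E : Type u} (V : Finset E → ℝ) (Λ : Finset E) (ξ : Set E) : ℝ :=
  ∑ ζ ∈ Λ.powerset, Real.exp (-energy V Λ ζ ξ)

/-- `γ_Λ(ζ; ξ) = exp (- H_Λ(ζ; ξ)) / Z_Λ(ξ)`. -/
def gibbsWeight {E : Type u} (V : Finset E → ℝ) (Λ ζ : Finset E) (ξ : Set E) : ℝ :=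
  Real.exp (-energy V Λ ζ ξ) / partitionFunction V Λ ξ

/-- The Gibbsian specification `γ_Λ(· | ξ) = ∑_{ζ ⊆ Λ} γ_Λ(ζ; ξ) δ_{ζ ∪ ξ_{Λᶜ}}`. -/
def specification {E : Type u} (V : Finset E → ℝ) (Λ : Finset E) (ξ : Set E) :
    MeasureTheory.Measure (Set E) :=
  ∑ ζ ∈ Λ.powerset, ENNReal.ofReal (gibbsWeight V Λ ζ ξ) •
    MeasureTheory.Measure.dirac ((ζ : Set E) ∪ (ξ \ (Λ : Set E)))

/-- `μ` is a Gibbs measure for the potential energy `V`: a probability measure satisfying the DLR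
equations `μ(B) = ∫ γ_Λ(B | ξ) dμ(ξ)` for all measurable `B` and finite `Λ`. -/
def IsGibbs {E : Type u} (V : Finset E → ℝ) (μ : MeasureTheory.Measure (Set E)) : Prop :=
  MeasureTheory.IsProbabilityMeasure μ ∧
    ∀ (Λ : Finset E) (B : Set (Set E)), MeasurableSet B →
      μ B = ∫⁻ ξ, specification V Λ ξ B ∂μ

end

end DPPGibbs

namespace DPPGibbs
open Classical Matrix Finset
universe u v
noncomputable section

/-! The functional completion turns `A` into a Gram matrix: A = J*J and a_x = J e_x lie in a Hilbert
space H, where the reproducing kernels b_x form a total family with (b_x, a_y) = δ_xy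
(`HypH.exists_factorization`). Let Q_S be the projection onto the orthogonal complement of {a_y : y
∈ S}. Gram determinants have one-point ratios ‖Q_S a_x‖².

Energies: as S increases, Q_S a_x converges, and the limit is nonzero because (b_x, Q_S a_x) = 1 for
x ∉ S. Multiplying one-point ratios gives `IsFactorization.exists_weight`.

Existence: μ is a cluster point of the finite-volume L-ensembles with weights det A_ζ. The
probability of seeing S in a window Δ is, up to normalisation, a Gram determinant of vectors
augmented by orthonormal components outside Δ. Inserting x multiplies it by a factor between α⁴/(α²
+ τ) and α², where α = ‖Q_S a_x‖ and τ bounds the ℓ² mass of J*Q_S a_x off Δ. When Q_S a_x converges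
as Δ grows, so does J*Q_S a_x in ℓ², hence τ can be taken to tend to 0. So conditional probabilities
in finite windows converge to the Gibbs weights at every ξ (`IsFactorization.tendsto_conditional`),
and dominated convergence gives the DLR equations (`IsFactorization.isGibbs`).

Uniqueness: under boundary condition S, the correlations in Λ are minors of 1 - N, where N inverts 1
+ (Q_S a_x, Q_S a_y) on Λ. Totality of b makes Q_S v → v as Λ grows, uniformly over S disjoint from
Λ, and coercivity then gives N → (1 + A)⁻¹ entrywise (`galerkin_bound`). Thus the correlations tend
to minors of K uniformly in S (`IsFactorization.tendsto_correlation`). Empty boundary conditions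
identify μ as the determinantal process; averaging over an arbitrary Gibbs measure forces its
correlations to be the same (`IsFactorization.real_superset_of_isGibbs`). -/

/-- The principal minor of `M` on the finite index set `S`. -/
def minor {E : Type u} (M : Matrix E E ℂ) (S : Finset E) : ℂ :=
  (M.submatrix (Subtype.val : S → E) (Subtype.val : S → E)).det

/-! ### Principal minors and correlation functions of finite L-ensembles. -/

section Minor

variable {E : Type u} (M : Matrix E E ℂ)

lemma subDet_eq_minor (T : L2 E →L[ℂ] L2 E) (X : Finset E) :
    subDet T X = minor (Matrix.of (matElem T)) X := rfl

lemma minor_congr {M N : Matrix E E ℂ} {S : Finset E} (h : ∀ i ∈ S, ∀ j ∈ S, M i j = N i j) :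
    minor M S = minor N S := by
  unfold minor
  congr 1
  ext i j
  exact h i i.2 j j.2

lemma minor_empty : minor M ∅ = 1 := by simp [minor]

lemma minor_singleton (x : E) : minor M {x} = M x x := by
  simp [minor, Matrix.det_unique]

lemma minor_union {S T : Finset E} (h : Disjoint S T) :
    minor M (S ∪ T) =
      (fromBlocks (M.submatrix (Subtype.val : S → E) (Subtype.val : S → E))
        (M.submatrix (Subtype.val : S → E) (Subtype.val : T → E))
        (M.submatrix (Subtype.val : T → E) (Subtype.val : S → E))
        (M.submatrix (Subtype.val : T → E) (Subtype.val : T → E))).det := by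
  rw [minor, ← det_submatrix_equiv_self (Equiv.Finset.union S T h)]
  congr 1
  ext i j
  rcases i with i | i <;> rcases j with j | j <;> simp

lemma minor_insert_of_row {S : Finset E} {x : E} (hx : x ∉ S) (h : ∀ j ∈ S, M x j = 0) :
    minor M (insert x S) = M x x * minor M S := by
  have h0 : M.submatrix (Subtype.val : ({x} : Finset E) → E) (Subtype.val : S → E) = 0 := by
    ext i j
    have : (i : E) = x := mem_singleton.1 i.2
    simp [this, h j j.2]
  rw [insert_eq, minor_union M (by simpa using hx), h0, det_fromBlocks_zero₁₂]
  rw [← minor_singleton M x]; rfl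

/-- The columns indexed by `T` are unit vectors, so the matrix is block lower triangular with an
identity block. -/
lemma minor_union_of_col {S T : Finset E} (hd : Disjoint S T)
    (h : ∀ i ∈ S ∪ T, ∀ j ∈ T, M i j = if i = j then 1 else 0) :
    minor M (S ∪ T) = minor M S := by
  have h0 : M.submatrix (Subtype.val : S → E) (Subtype.val : T → E) = 0 := by
    ext i j
    have : (i : E) ≠ j := fun e => disjoint_left.1 hd i.2 (e ▸ j.2)
    simp [h i (mem_union_left _ i.2) j j.2, this]
  have h1 : M.submatrix (Subtype.val : T → E) (Subtype.val : T → E) = 1 := by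
    ext i j
    rw [submatrix_apply, h i (mem_union_right _ i.2) j j.2, Matrix.one_apply]
    simp only [Subtype.ext_iff]
  rw [minor_union M hd, h0, h1, det_fromBlocks_zero₁₂, det_one, mul_one]
  rfl

/-- The diagonal matrix which is the indicator of `R`. -/
def diagOn {E : Type u} (R : Finset E) : Matrix E E ℂ := diagonal fun i => if i ∈ R then 1 else 0

lemma diagOn_apply (R : Finset E) (i j : E) :
    diagOn R i j = if i = j ∧ i ∈ R then 1 else 0 := by
  by_cases h : i = j <;> simp [diagOn, h]

/-- Linearity of the determinant in row `x`: the extra diagonal entry adds a unit vector to that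
row, and the determinant with this unit row is the minor on `S`. -/
lemma minor_add_diagOn_insert {S R : Finset E} {x : E} (hx : x ∉ S) (hR : x ∉ R) :
    minor (M + diagOn (insert x R)) (insert x S) =
      minor (M + diagOn R) (insert x S) + minor (M + diagOn R) S := by
  set N := M + diagOn R
  set D : Matrix E E ℂ := Matrix.updateRow N x (Pi.single x 1) with hD
  have h1 : minor D (insert x S) = minor N S := by
    rw [minor_insert_of_row D hx]
    · simp only [hD, updateRow_self, Pi.single_eq_same, one_mul]
      apply minor_congr
      intro i hi j _
      rw [updateRow_ne]
      rintro rfl; exact hx hi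
    · intro j hj
      have : j ≠ x := by rintro rfl; exact hx hj
      simp [hD, this]
  rw [← h1]
  unfold minor
  let x' : ↥(insert x S) := ⟨x, mem_insert_self x S⟩
  have e1 : (M + diagOn (insert x R)).submatrix (Subtype.val : ↥(insert x S) → E) Subtype.val =
      updateRow (N.submatrix (Subtype.val : ↥(insert x S) → E) Subtype.val) x'
        ((fun j : ↥(insert x S) => N x j) + fun j : ↥(insert x S) => (Pi.single x 1 : E → ℂ) j) := by
    ext i j
    by_cases hi : i = x'
    · subst hi
      rw [updateRow_self]
      simp [N, x', diagOn_apply, hR, Pi.single_apply, eq_comm]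
    · rw [updateRow_ne hi]
      have : (i : E) ≠ x := fun e => hi (Subtype.ext e)
      simp [N, diagOn_apply, this]
  have e2 : D.submatrix (Subtype.val : ↥(insert x S) → E) Subtype.val =
      updateRow (N.submatrix (Subtype.val : ↥(insert x S) → E) Subtype.val) x'
        (fun j : ↥(insert x S) => (Pi.single x 1 : E → ℂ) j) := by
    ext i j
    by_cases hi : i = x'
    · subst hi
      rw [updateRow_self]
      simp [hD, x']
    · rw [updateRow_ne hi]
      have : (i : E) ≠ x := fun e => hi (Subtype.ext e)
      simp [hD, this]
  have e3 : N.submatrix (Subtype.val : ↥(insert x S) → E) Subtype.val =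
      updateRow (N.submatrix (Subtype.val : ↥(insert x S) → E) Subtype.val) x'
        (fun j : ↥(insert x S) => N x j) := by
    ext i j
    by_cases hi : i = x'
    · subst hi
      rw [updateRow_self]; rfl
    · rw [updateRow_ne hi]
  rw [e1, e2, det_updateRow_add, ← e3]

lemma sum_minor_union {S R : Finset E} (h : Disjoint S R) :
    ∑ X ∈ R.powerset, minor M (S ∪ X) = minor (M + diagOn R) (S ∪ R) := by
  induction R using Finset.induction_on generalizing S with
  | empty =>
    simp only [powerset_empty, sum_singleton, union_empty]
    apply minor_congr; intro i _ j _; simp [diagOn_apply]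
  | insert x R hx ih =>
    rw [disjoint_insert_right] at h
    rw [sum_powerset_insert hx, ih h.2, union_insert,
      minor_add_diagOn_insert M (S := S ∪ R) (by simp [hx, h.1]) hx, add_comm, ← insert_union,
      ← ih (S := insert x S) (by simp [hx, h.2])]
    congr 1
    apply sum_congr rfl
    intro X _
    rw [union_insert, insert_union]

/-- Correlation functions of an L-ensemble. -/
lemma sum_minor_superset {L N : Matrix E E ℂ} {Λ X : Finset E} (hX : X ⊆ Λ)
    (hN : ∀ i ∈ Λ, ∀ k ∈ Λ, ∑ j ∈ Λ, (1 + L) i j * N j k = if i = k then 1 else 0) :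
    ∑ ζ ∈ Λ.powerset with X ⊆ ζ, minor L ζ =
      (∑ ζ ∈ Λ.powerset, minor L ζ) * minor (1 - N) X := by
  have hd : Disjoint X (Λ \ X) := disjoint_sdiff
  have hs : ∑ ζ ∈ Λ.powerset with X ⊆ ζ, minor L ζ = ∑ Y ∈ (Λ \ X).powerset, minor L (X ∪ Y) := by
    symm
    refine sum_bij' (fun Y _ => X ∪ Y) (fun ζ _ => ζ \ X) ?_ ?_ ?_ ?_ ?_
    · intro Y hY
      simp only [mem_filter, mem_powerset] at hY ⊢
      exact ⟨union_subset hX (hY.trans sdiff_subset), subset_union_left⟩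
    · intro ζ hζ
      simp only [mem_filter, mem_powerset] at hζ ⊢
      exact sdiff_subset_sdiff hζ.1 subset_rfl
    · intro Y hY
      simp only [mem_powerset] at hY
      rw [union_sdiff_cancel_left (hd.mono_right hY)]
    · intro ζ hζ
      simp only [mem_filter] at hζ
      exact union_sdiff_of_subset hζ.2
    · simp
  have hone := sum_minor_union L (disjoint_empty_left Λ)
  simp only [empty_union] at hone
  rw [hs, sum_minor_union L hd, union_sdiff_of_subset hX, hone]
  -- The columns of `D` in `X` are those of `1 - N`, the others those of the identity. Hence on `Λ`
  -- the product `(1 + L) * D` is `L` plus the indicator of `Λ \ X`, and the claim is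
  -- multiplicativity of the determinant.
  set D : Matrix E E ℂ := Matrix.of fun i j =>
    (if i = j then 1 else 0) - if j ∈ X then N i j else 0 with hD
  have hcol := minor_union_of_col D hd (by
    intro i _ j hj
    simp [hD, (mem_sdiff.1 hj).2])
  rw [union_sdiff_of_subset hX] at hcol
  have hDX : minor D X = minor (1 - N) X := by
    apply minor_congr
    intro i _ j hj
    simp [hD, hj, Matrix.one_apply]
  have hΛ : minor (L + diagOn Λ) Λ = minor (1 + L) Λ := by
    apply minor_congr
    intro i hi j _
    simp [diagOn_apply, hi, Matrix.one_apply, add_comm]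
  rw [hΛ, ← hDX, ← hcol]
  unfold minor
  rw [← det_mul]
  congr 1
  ext i k
  rw [mul_apply]
  simp only [submatrix_apply, hD, of_apply, mul_sub]
  rw [sum_sub_distrib]
  have e1 : ∑ j : Λ, (1 + L) i j * (if (j : E) = k then 1 else 0) = (1 + L) i k := by
    simp only [← Subtype.ext_iff, mul_ite, mul_one, mul_zero, sum_ite_eq', mem_univ, if_true]
  have e2 : ∑ j : Λ, (1 + L) i j * (if (k : E) ∈ X then N j k else 0) =
      if (k : E) ∈ X then (if (i : E) = k then 1 else 0) else 0 := by
    by_cases hk : (k : E) ∈ X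
    · simp only [hk, if_true]
      rw [← hN i i.2 k k.2, sum_coe_sort Λ (fun j => (1 + L) i j * N j k)]
    · simp [hk]
  rw [e1, e2]
  by_cases hik : (i : E) = k
  · by_cases hk : (k : E) ∈ X <;> simp [hik, hk, diagOn_apply, add_comm]
  · by_cases hk : (k : E) ∈ X <;> simp [hik, hk, diagOn_apply]

end Minor

/-! ### Gram matrices and orthogonal complements of finite spans. -/

section Gram
variable {E : Type u} {H : Type v} [NormedAddCommGroup H] [InnerProductSpace ℂ H]

/-- The span of the vectors `a y`, `y ∈ S`. -/
def spanOn (a : E → H) (S : Finset E) : Submodule ℂ H := Submodule.span ℂ (a '' (S : Set E))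

instance (a : E → H) (S : Finset E) : FiniteDimensional ℂ (spanOn a S) :=
  FiniteDimensional.span_of_finite ℂ (S.finite_toSet.image a)

/-- The component of `v` orthogonal to the span of the vectors `a y`, `y ∈ S`. -/
def orthPart (a : E → H) (S : Finset E) (v : H) : H := v - (spanOn a S).starProjection v

lemma mem_spanOn (a : E → H) {S : Finset E} {x : E} (hx : x ∈ S) : a x ∈ spanOn a S :=
  Submodule.subset_span ⟨x, hx, rfl⟩

lemma spanOn_mono (a : E → H) {S T : Finset E} (h : S ⊆ T) : spanOn a S ≤ spanOn a T :=
  Submodule.span_mono (Set.image_mono (by exact_mod_cast h))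

lemma orthPart_mem_orthogonal (a : E → H) (S : Finset E) (v : H) :
    orthPart a S v ∈ (spanOn a S)ᗮ :=
  Submodule.sub_starProjection_mem_orthogonal v

lemma inner_orthPart_of_mem {a : E → H} {S : Finset E} {w : H} (hw : w ∈ spanOn a S) (v : H) :
    inner ℂ w (orthPart a S v) = 0 :=
  (orthPart_mem_orthogonal a S v) w hw

lemma orthPart_of_inner_eq_zero {a : E → H} {S : Finset E} {w : H}
    (hw : ∀ y ∈ S, inner ℂ (a y) w = 0) : orthPart a S w = w := by
  have : w ∈ (spanOn a S)ᗮ := by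
    rw [spanOn, Submodule.mem_orthogonal]
    intro u hu
    induction hu using Submodule.span_induction with
    | mem u hu => obtain ⟨y, hy, rfl⟩ := hu; exact hw y hy
    | zero => simp
    | add u v _ _ hu hv => rw [inner_add_left, hu, hv, add_zero]
    | smul c u _ hu => rw [inner_smul_left, hu, mul_zero]
  rw [orthPart, (Submodule.starProjection_apply_eq_zero_iff _).2 this, sub_zero]

lemma inner_orthPart_left (a : E → H) (S : Finset E) (v w : H) :
    inner ℂ (orthPart a S v) (orthPart a S w) = inner ℂ v (orthPart a S w) := by
  conv_lhs => rw [orthPart, inner_sub_left,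
    inner_orthPart_of_mem (Submodule.starProjection_apply_mem _ _), sub_zero]

lemma orthPart_sub (a : E → H) (S : Finset E) (v w : H) :
    orthPart a S (v - w) = orthPart a S v - orthPart a S w := by
  simp only [orthPart, map_sub]; abel

lemma norm_orthPart_le (a : E → H) (S : Finset E) (v : H) : ‖orthPart a S v‖ ≤ ‖v‖ := by
  have h : ‖orthPart a S v‖ * ‖orthPart a S v‖ ≤ ‖v‖ * ‖orthPart a S v‖ := by
    rw [← inner_self_eq_norm_mul_norm (𝕜 := ℂ), inner_orthPart_left]
    exact re_inner_le_norm _ _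
  rcases (norm_nonneg (orthPart a S v)).eq_or_lt with h0 | h0
  · rw [← h0]; exact norm_nonneg v
  · exact le_of_mul_le_mul_right h h0

/-- Schur complement formula for Gram determinants. -/
lemma minor_gram_union (a : E → H) {ζ S : Finset E} (h : Disjoint ζ S) :
    minor (gram ℂ a) (ζ ∪ S) =
      minor (gram ℂ fun x => orthPart a S (a x)) ζ * minor (gram ℂ a) S := by
  have hc : ∀ x, ∃ c : E → ℂ, (spanOn a S).starProjection (a x) = ∑ s ∈ S, c s • a s := by
    intro x
    have hm := Submodule.starProjection_apply_mem (spanOn a S) (a x)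
    have hm' := (Submodule.mem_span_image_finset_iff_exists_fun' ℂ).1 hm
    obtain ⟨c, hc⟩ := hm'
    exact ⟨c, hc.symm⟩
  choose c hc using hc
  set P : E → H := fun x => (spanOn a S).starProjection (a x) with hP
  have hdec : ∀ x, a x = orthPart a S (a x) + P x := fun x => by simp [orthPart, hP]
  have hPm : ∀ x, P x ∈ spanOn a S := fun x => Submodule.starProjection_apply_mem _ _
  have h1 : ∀ x, ∀ w ∈ spanOn a S, inner ℂ w (a x) = inner ℂ w (P x) := by
    intro x w hw
    conv_lhs => rw [hdec x, inner_add_right, inner_orthPart_of_mem hw, zero_add]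
  have h2 : ∀ x, ∀ w ∈ spanOn a S, inner ℂ (a x) w = inner ℂ (P x) w := by
    intro x w hw
    rw [← inner_conj_symm, h1 x w hw, inner_conj_symm]
  rw [minor_union _ h]
  set C : Matrix ζ S ℂ := Matrix.of fun x s => c x s
  set G := (gram ℂ a).submatrix (Subtype.val : S → E) (Subtype.val : S → E) with hG
  set Q := (gram ℂ fun x => orthPart a S (a x)).submatrix (Subtype.val : ζ → E)
    (Subtype.val : ζ → E)
  have e1 : (gram ℂ a).submatrix (Subtype.val : ζ → E) (Subtype.val : S → E) =
      C.map (starRingEnd ℂ) * G := by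
    ext x s
    rw [mul_apply]
    simp only [submatrix_apply, gram_apply, C, hG, map_apply, of_apply]
    rw [h2 x (a s) (mem_spanOn a s.2), hP]
    simp only [hc, sum_inner, inner_smul_left]
    rw [sum_coe_sort S (fun t => (starRingEnd ℂ) (c x t) * inner ℂ (a t) (a s))]
  have e2 : (gram ℂ a).submatrix (Subtype.val : S → E) (Subtype.val : ζ → E) = G * Cᵀ := by
    ext s x
    rw [mul_apply]
    simp only [submatrix_apply, gram_apply, C, hG, transpose_apply, of_apply]
    rw [h1 x (a s) (mem_spanOn a s.2), hP]
    simp only [hc, inner_sum, inner_smul_right]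
    rw [sum_coe_sort S (fun t => inner ℂ (a s) (a t) * (c x t))]
    exact sum_congr rfl fun _ _ => mul_comm _ _
  have e3 : (gram ℂ a).submatrix (Subtype.val : ζ → E) (Subtype.val : ζ → E) =
      Q + C.map (starRingEnd ℂ) * G * Cᵀ := by
    rw [← e1]
    ext x y
    rw [Matrix.add_apply, mul_apply]
    simp only [submatrix_apply, gram_apply, C, Q, transpose_apply, of_apply]
    rw [inner_orthPart_left]
    conv_lhs => rw [hdec y, inner_add_right]
    congr 1
    simp only [hP, hc, inner_sum, inner_smul_right]
    rw [sum_coe_sort S (fun t => inner ℂ (a x) (a t) * (c y t))]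
    exact sum_congr rfl fun _ _ => mul_comm _ _
  -- Block elimination: the outer factors are unit triangular, so only `Q` and `G` contribute to the
  -- determinant.
  have e4 : fromBlocks (Q + C.map (starRingEnd ℂ) * G * Cᵀ) (C.map (starRingEnd ℂ) * G)
      (G * Cᵀ) G = fromBlocks 1 (C.map (starRingEnd ℂ)) 0 1 * fromBlocks Q 0 0 G *
        fromBlocks 1 0 Cᵀ 1 := by
    simp [fromBlocks_multiply]
  rw [e1, e2, e3, e4, det_mul, det_mul, det_fromBlocks_zero₂₁, det_fromBlocks_zero₂₁,
    det_fromBlocks_zero₁₂]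
  simp only [det_one, one_mul, mul_one]
  rfl

end Gram
end
end DPPGibbs

namespace DPPGibbs
open Classical Matrix Finset Filter Topology
open scoped ComplexOrder
universe u v
noncomputable section

/-! ### Gram determinants, biorthogonality and convergence of ratios. -/

section GramDet
variable {E : Type u} {H : Type v} [NormedAddCommGroup H] [InnerProductSpace ℂ H]

/-- The Gram determinant of the vectors `a x`, `x ∈ S`. -/
def gramDet (a : E → H) (S : Finset E) : ℝ := (minor (gram ℂ a) S).re

lemma minor_gram_nonneg (a : E → H) (S : Finset E) : 0 ≤ minor (gram ℂ a) S :=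
  (posSemidef_gram ℂ fun x : S => a x).det_nonneg

lemma ofReal_gramDet (a : E → H) (S : Finset E) : (gramDet a S : ℂ) = minor (gram ℂ a) S := by
  have h := (Complex.nonneg_iff.1 (minor_gram_nonneg a S)).2
  apply Complex.ext
  · simp [gramDet]
  · simp [← h]

lemma gramDet_nonneg (a : E → H) (S : Finset E) : 0 ≤ gramDet a S :=
  (Complex.nonneg_iff.1 (minor_gram_nonneg a S)).1

lemma gramDet_empty (a : E → H) : gramDet a ∅ = 1 := by simp [gramDet, minor_empty]

lemma gramDet_union (a : E → H) {ζ S : Finset E} (h : Disjoint ζ S) :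
    gramDet a (ζ ∪ S) = gramDet (fun x => orthPart a S (a x)) ζ * gramDet a S := by
  have := minor_gram_union a h
  rw [← ofReal_gramDet, ← ofReal_gramDet, ← ofReal_gramDet] at this
  exact_mod_cast this

lemma gramDet_insert (a : E → H) {x : E} {S : Finset E} (h : x ∉ S) :
    gramDet a (insert x S) = ‖orthPart a S (a x)‖ ^ 2 * gramDet a S := by
  rw [insert_eq, gramDet_union a (by simpa using h)]
  congr 1
  rw [gramDet, minor_singleton, gram_apply, ← inner_self_eq_norm_sq (𝕜 := ℂ)]
  rfl

/-- The families `b` and `a` are biorthogonal. -/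
def Biorthogonal (b a : E → H) : Prop := ∀ x y, inner ℂ (b x) (a y) = if x = y then 1 else 0

variable {a b : E → H}

lemma Biorthogonal.inner_spanOn (hab : Biorthogonal b a) {S : Finset E} {x : E} (hx : x ∉ S)
    {w : H} (hw : w ∈ spanOn a S) : inner ℂ (b x) w = 0 := by
  unfold spanOn at hw
  induction hw using Submodule.span_induction with
  | mem u hu =>
    obtain ⟨y, hy, rfl⟩ := hu
    rw [hab, if_neg]
    rintro rfl
    exact hx hy
  | zero => simp
  | add u v _ _ hu hv => rw [inner_add_right, hu, hv, add_zero]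
  | smul c u _ hu => rw [inner_smul_right, hu, mul_zero]

/-- The projection removes a vector of the span, to which `b x` is orthogonal. This keeps `a x` at
distance at least `1 / ‖b x‖` from every such span, uniformly in `S`. -/
lemma Biorthogonal.inner_orthPart (hab : Biorthogonal b a) {S : Finset E} {x : E} (hx : x ∉ S) :
    inner ℂ (b x) (orthPart a S (a x)) = 1 := by
  rw [orthPart, inner_sub_right, hab.inner_spanOn hx (Submodule.starProjection_apply_mem _ _),
    hab, if_pos rfl, sub_zero]

lemma Biorthogonal.orthPart_pos (hab : Biorthogonal b a) {S : Finset E} {x : E} (hx : x ∉ S) :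
    0 < ‖orthPart a S (a x)‖ := by
  rw [norm_pos_iff]
  intro h
  have := hab.inner_orthPart hx
  rw [h, inner_zero_right] at this
  exact zero_ne_one this

lemma Biorthogonal.gramDet_pos (hab : Biorthogonal b a) (S : Finset E) : 0 < gramDet a S := by
  induction S using Finset.induction_on with
  | empty => rw [gramDet_empty]; exact one_pos
  | insert x S hx ih =>
    rw [gramDet_insert a hx]
    have := hab.orthPart_pos hx
    positivity

lemma orthPart_eq_of_mem {S : Finset E} {v w : H} (hw : w ∈ spanOn a S) :
    orthPart a S (v - w) = orthPart a S v := by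
  rw [orthPart_sub, orthPart, orthPart, Submodule.starProjection_eq_self_iff.2 hw]
  simp

lemma norm_orthPart_le_sub {S : Finset E} {v w : H} (hw : w ∈ spanOn a S) :
    ‖orthPart a S v‖ ≤ ‖v - w‖ := by
  rw [← orthPart_eq_of_mem hw]
  exact norm_orthPart_le _ _ _

/-- Projections onto an increasing family of subspaces converge strongly to the projection onto the
closure of their union. -/
lemma exists_tendsto_orthPart [CompleteSpace H] (a : E → H) {ι : Type*} [Preorder ι]
    {T : ι → Finset E} (hT : Monotone T) (v : H) :
    ∃ q, Tendsto (fun i => orthPart a (T i) v) atTop (𝓝 q) :=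
  ⟨_, tendsto_const_nhds.sub (Submodule.starProjection_tendsto_closure_iSup
    (fun i => spanOn a (T i)) (fun _ _ h => spanOn_mono a (hT h)) v)⟩

lemma Biorthogonal.tendsto_orthPart_ne_zero (hab : Biorthogonal b a) {ι : Type*} {l : Filter ι}
    [l.NeBot] {T : ι → Finset E} {x : E} (hx : ∀ i, x ∉ T i) {q : H}
    (hq : Tendsto (fun i => orthPart a (T i) (a x)) l (𝓝 q)) : q ≠ 0 := by
  rintro rfl
  have h1 : Tendsto (fun i => inner ℂ (b x) (orthPart a (T i) (a x))) l (𝓝 (inner ℂ (b x) 0)) :=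
    tendsto_const_nhds.inner hq
  simp only [hab.inner_orthPart (hx _), inner_zero_right] at h1
  exact one_ne_zero (tendsto_nhds_unique tendsto_const_nhds h1)

/-- A positive function of finite configurations whose one-point ratios are asymptotic to squared
distances has convergent ratios. -/
lemma exists_tendsto_ratio [CompleteSpace H] (hab : Biorthogonal b a) {ι : Type*} [Preorder ι]
    [IsDirectedOrder ι] [Nonempty ι] {S : ι → Finset E} (hS : Monotone S) (ζ : Finset E)
    (hζ : ∀ i, Disjoint ζ (S i)) :
    ∃ w : ℝ, 0 < w ∧
      ∀ (π : ι → Finset E → ℝ), (∀ᶠ i in atTop, ∀ ζ' ⊆ ζ, 0 < π i (ζ' ∪ S i)) →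
        (∀ ζ' ⊆ ζ, ∀ x ∈ ζ, x ∉ ζ' → ∀ q : H, q ≠ 0 →
          Tendsto (fun i => orthPart a (ζ' ∪ S i) (a x)) atTop (𝓝 q) →
          Tendsto (fun i => π i (insert x ζ' ∪ S i) / π i (ζ' ∪ S i)) atTop (𝓝 (‖q‖ ^ 2))) →
        Tendsto (fun i => π i (ζ ∪ S i) / π i (S i)) atTop (𝓝 w) := by
  induction ζ using Finset.induction_on with
  | empty =>
    refine ⟨1, one_pos, fun π h0 _ => ?_⟩
    refine tendsto_const_nhds.congr' ?_
    filter_upwards [h0] with i hi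
    have := hi ∅ subset_rfl
    rw [empty_union] at this ⊢
    rw [div_self this.ne']
  | insert x ζ hx ih =>
    obtain ⟨w, hw, h⟩ := ih (fun i => (disjoint_insert_left.1 (hζ i)).2)
    have hxi : ∀ i, x ∉ ζ ∪ S i := fun i => by
      simp [hx, (disjoint_insert_left.1 (hζ i)).1]
    obtain ⟨q, hq⟩ := exists_tendsto_orthPart a (T := fun i => ζ ∪ S i)
      (fun i j hij => union_subset_union_right (hS hij)) (a x)
    have hq0 := hab.tendsto_orthPart_ne_zero hxi hq
    -- The limit is built from the vectors alone, before `π` is introduced; this is why Gram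
    -- determinants and window probabilities will share it.
    refine ⟨‖q‖ ^ 2 * w, by positivity, fun π h0 h1 => ?_⟩
    have e1 := h π (h0.mono fun i hi ζ' h' => hi ζ' (h'.trans (subset_insert _ _)))
      fun ζ' h' y hy => h1 ζ' (h'.trans (subset_insert _ _)) y (mem_insert_of_mem hy)
    have e2 := h1 ζ (subset_insert _ _) x (mem_insert_self _ _) hx q hq0 hq
    refine (e2.mul e1).congr' ?_
    filter_upwards [h0] with i hi
    have := hi ζ (subset_insert _ _)
    rw [div_mul_div_cancel₀ this.ne']

lemma tendsto_gramDet_ratio (hab : Biorthogonal b a) {ι : Type*} {l : Filter ι}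
    {T : ι → Finset E} {x : E} (hx : ∀ i, x ∉ T i) {q : H}
    (hq : Tendsto (fun i => orthPart a (T i) (a x)) l (𝓝 q)) :
    Tendsto (fun i => gramDet a (insert x (T i)) / gramDet a (T i)) l (𝓝 (‖q‖ ^ 2)) := by
  refine (hq.norm.pow 2).congr fun i => ?_
  rw [gramDet_insert a (hx i), mul_div_cancel_right₀ _ (hab.gramDet_pos _).ne']

end GramDet

/-! ### Augmented vectors: summing over the configuration outside a window. -/

section Augmented
variable {E : Type u} {H : Type v} [NormedAddCommGroup H] [InnerProductSpace ℂ H]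

lemma inner_basisVec_left (x : E) (f : L2 E) : inner ℂ (basisVec x) f = f x := by
  simp [basisVec, lp.inner_single_left]

lemma basisVec_apply (x y : E) : (basisVec x : L2 E) y = if x = y then 1 else 0 := by
  simp [basisVec, lp.single_apply, Pi.single_apply, eq_comm]

/-- The vectors `a x`, augmented by an orthonormal family on `R`. -/
def augment (a : E → H) (R : Finset E) (x : E) : WithLp 2 (H × L2 E) :=
  WithLp.toLp 2 (a x, if x ∈ R then basisVec x else 0)

variable (a b : E → H)

lemma gram_augment (R : Finset E) : gram ℂ (augment a R) = gram ℂ a + diagOn R := by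
  ext x y
  simp only [gram_apply, augment, WithLp.prod_inner_apply, Matrix.add_apply, diagOn_apply]
  congr 1
  by_cases hx : x ∈ R <;> by_cases hy : y ∈ R <;>
    simp [hx, hy, inner_basisVec_left, basisVec_apply, eq_comm]
  all_goals rintro rfl; exact absurd hx hy

variable {a b}

lemma Biorthogonal.augment (hab : Biorthogonal b a) (R : Finset E) :
    Biorthogonal (fun x => WithLp.toLp 2 (b x, (0 : L2 E))) (DPPGibbs.augment a R) := by
  intro x y
  simp [DPPGibbs.augment, WithLp.prod_inner_apply, hab x y]

/-- Summing minors over `X` adds the indicator of `R` to the Gram matrix, which is what orthonormal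
extra components do. Marginals are therefore Gram determinants again, with squared distances as
one-point ratios. -/
lemma sum_gramDet_union (a : E → H) {S R : Finset E} (h : Disjoint S R) :
    ∑ X ∈ R.powerset, gramDet a (S ∪ X) = gramDet (augment a R) (S ∪ R) := by
  rw [gramDet, gram_augment, ← sum_minor_union _ h, Complex.re_sum]
  rfl

variable {R S : Finset E} {x : E}

/-- For `y ∈ S` the augmented vector has zero second component, so the projection of `a x`, padded
by zero, is a competitor in the augmented span. -/
lemma norm_orthPart_augment_le (hx : x ∉ R) (hS : Disjoint S R) :
    ‖orthPart (augment a R) (S ∪ R) (augment a R x)‖ ≤ ‖orthPart a S (a x)‖ := by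
  have hmem : WithLp.toLp 2 ((spanOn a S).starProjection (a x), (0 : L2 E)) ∈
      spanOn (augment a R) (S ∪ R) := by
    have := Submodule.starProjection_apply_mem (spanOn a S) (a x)
    revert this
    generalize (spanOn a S).starProjection (a x) = w
    intro hw
    unfold spanOn at hw
    induction hw using Submodule.span_induction with
    | mem u hu =>
      obtain ⟨y, hy, rfl⟩ := hu
      have : augment a R y = WithLp.toLp 2 (a y, (0 : L2 E)) := by
        rw [augment, if_neg (disjoint_left.1 hS hy)]
      rw [← this]
      exact mem_spanOn _ (mem_union_left _ hy)
    | zero => exact Submodule.zero_mem _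
    | add u v _ _ hu hv =>
      convert Submodule.add_mem _ hu hv using 1
      rw [← WithLp.toLp_add]; simp
    | smul c u _ hu =>
      convert Submodule.smul_mem _ c hu using 1
      rw [← WithLp.toLp_smul]; simp
  refine (norm_orthPart_le_sub hmem).trans ?_
  rw [augment, if_neg hx, ← WithLp.toLp_sub]
  simp [orthPart]

/-- Cauchy–Schwarz against a test vector orthogonal to all augmented vectors of `S ∪ R`, whose inner
product with the one at `x` is `‖q‖ ^ 2`. -/
lemma le_norm_orthPart_augment (hx : x ∉ R) :
    ‖orthPart a S (a x)‖ ^ 4 ≤ ‖orthPart (augment a R) (S ∪ R) (augment a R x)‖ ^ 2 *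
      (‖orthPart a S (a x)‖ ^ 2 + ∑ y ∈ R, ‖inner ℂ (a y) (orthPart a S (a x))‖ ^ 2) := by
  set q := orthPart a S (a x) with hq
  -- These coefficients cancel `inner (a y) q` for `y ∈ R`; for `y ∈ S` outside `R` orthogonality
  -- already comes from `q`.
  set f : L2 E := ∑ y ∈ R, (-inner ℂ (a y) q) • basisVec y with hf
  have hfy : ∀ y, f y = if y ∈ R then -inner ℂ (a y) q else 0 := by
    intro y
    rw [← inner_basisVec_left, hf, inner_sum]
    simp only [inner_smul_right, inner_basisVec_left, basisVec_apply]
    simp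
  have hfn : ‖f‖ ^ 2 = ∑ y ∈ R, ‖inner ℂ (a y) q‖ ^ 2 := by
    rw [← inner_self_eq_norm_sq (𝕜 := ℂ)]
    conv_lhs => rw [hf]
    rw [sum_inner, map_sum]
    refine sum_congr rfl fun y hy => ?_
    rw [inner_smul_left, inner_basisVec_left, hfy, if_pos hy, RCLike.conj_mul, norm_neg,
      ← RCLike.ofReal_pow, RCLike.ofReal_re]
  set w : WithLp 2 (H × L2 E) := WithLp.toLp 2 (q, f) with hw
  have hwn : ‖w‖ ^ 2 = ‖q‖ ^ 2 + ∑ y ∈ R, ‖inner ℂ (a y) q‖ ^ 2 := by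
    rw [WithLp.prod_norm_sq_eq_of_L2, ← hfn]; rfl
  have hw0 : ∀ y ∈ S ∪ R, inner ℂ (augment a R y) w = 0 := by
    intro y hy
    rw [augment, hw, WithLp.prod_inner_apply]
    by_cases hyR : y ∈ R
    · simp [hyR, inner_basisVec_left, hfy]
    · have hyS : y ∈ S := (mem_union.1 hy).resolve_right hyR
      simp [hyR, hq, inner_orthPart_of_mem (mem_spanOn a hyS)]
  have h1 : inner ℂ (orthPart (augment a R) (S ∪ R) (augment a R x)) w = (‖q‖ ^ 2 : ℝ) := by
    rw [← orthPart_of_inner_eq_zero hw0, inner_orthPart_left, orthPart_of_inner_eq_zero hw0,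
      augment, hw, WithLp.prod_inner_apply]
    simp only [hx, if_false, inner_zero_left, add_zero]
    rw [hq, ← inner_orthPart_left, inner_self_eq_norm_sq_to_K]
    simp
  have h2 := norm_inner_le_norm (𝕜 := ℂ) (orthPart (augment a R) (S ∪ R) (augment a R x)) w
  rw [h1, Complex.norm_real, Real.norm_of_nonneg (by positivity)] at h2
  calc ‖q‖ ^ 4 = (‖q‖ ^ 2) ^ 2 := by ring
    _ ≤ (‖orthPart (augment a R) (S ∪ R) (augment a R x)‖ * ‖w‖) ^ 2 := by gcongr
    _ = _ := by rw [mul_pow, hwn]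

lemma gramDet_augment_insert_le (hx : x ∉ S) (hR : x ∉ R) (hS : Disjoint S R) :
    gramDet (augment a R) (insert x S ∪ R) ≤
      ‖orthPart a S (a x)‖ ^ 2 * gramDet (augment a R) (S ∪ R) := by
  have hxSR : x ∉ S ∪ R := by simp only [mem_union, not_or]; exact ⟨hx, hR⟩
  rw [insert_union, gramDet_insert (augment a R) hxSR]
  exact mul_le_mul_of_nonneg_right
    (pow_le_pow_left₀ (norm_nonneg _) (norm_orthPart_augment_le hR hS) 2) (gramDet_nonneg _ _)

lemma le_gramDet_augment_insert (hx : x ∉ S) (hR : x ∉ R) :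
    ‖orthPart a S (a x)‖ ^ 4 * gramDet (augment a R) (S ∪ R) ≤
      gramDet (augment a R) (insert x S ∪ R) * (‖orthPart a S (a x)‖ ^ 2 +
        ∑ y ∈ R, ‖inner ℂ (a y) (orthPart a S (a x))‖ ^ 2) := by
  have hxSR : x ∉ S ∪ R := by simp only [mem_union, not_or]; exact ⟨hx, hR⟩
  rw [insert_union, gramDet_insert (augment a R) hxSR, mul_right_comm]
  exact mul_le_mul_of_nonneg_right (le_norm_orthPart_augment hR) (gramDet_nonneg _ _)

end Augmented
end
end DPPGibbs

namespace DPPGibbs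
open Classical Matrix Finset Filter Topology
open scoped ComplexOrder InnerProduct
universe u v
noncomputable section

/-! ### Tails of square-summable functions. -/

section Tail
variable {E : Type u}

lemma hasSum_norm_sq (f : L2 E) : HasSum (fun y => ‖f y‖ ^ 2) (‖f‖ ^ 2) := by
  have := lp.hasSum_norm (p := 2) (by norm_num) f
  simpa using this

/-- The restriction of `f` to `Λ`. -/
def trunc (Λ : Finset E) (f : L2 E) : L2 E := ∑ y ∈ Λ, f y • basisVec y

lemma tendsto_trunc (f : L2 E) : Tendsto (fun Λ => trunc Λ f) atTop (𝓝 f) := by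
  have := lp.hasSum_single (p := 2) (by norm_num) f
  refine Tendsto.congr (fun Λ => ?_) this
  refine sum_congr rfl fun y _ => ?_
  rw [basisVec, ← lp.single_smul]
  simp

/-- Off `Δ`, the mass of `f Δ` is controlled by `‖f Δ - g‖ ^ 2` and the tail of `g`, through `(s +
t)² ≤ 2s² + 2t²`. The bound does not involve `R`. -/
lemma exists_tail_bound {f : Finset E → L2 E} {g : L2 E} (h : Tendsto f atTop (𝓝 g)) :
    ∃ τ : Finset E → ℝ, Tendsto τ atTop (𝓝 0) ∧
      ∀ Δ R, Disjoint Δ R → ∑ y ∈ R, ‖f Δ y‖ ^ 2 ≤ τ Δ := by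
  refine ⟨fun Δ => 2 * ‖f Δ - g‖ ^ 2 + 2 * (‖g‖ ^ 2 - ∑ y ∈ Δ, ‖g y‖ ^ 2), ?_, ?_⟩
  · have h1 : Tendsto (fun Δ => ‖f Δ - g‖) atTop (𝓝 0) := tendsto_iff_norm_sub_tendsto_zero.1 h
    have h2 : Tendsto (fun Δ => ∑ y ∈ Δ, ‖g y‖ ^ 2) atTop (𝓝 (‖g‖ ^ 2)) := hasSum_norm_sq g
    have := ((h1.pow 2).const_mul 2).add ((h2.const_sub (‖g‖ ^ 2)).const_mul 2)
    simpa using this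
  · intro Δ R hd
    have h1 : ∑ y ∈ R, ‖(f Δ - g) y‖ ^ 2 ≤ ‖f Δ - g‖ ^ 2 :=
      sum_le_hasSum _ (fun _ _ => by positivity) (hasSum_norm_sq _)
    have h2 : ∑ y ∈ Δ ∪ R, ‖g y‖ ^ 2 ≤ ‖g‖ ^ 2 :=
      sum_le_hasSum _ (fun _ _ => by positivity) (hasSum_norm_sq _)
    rw [sum_union hd] at h2
    have h3 : ∑ y ∈ R, ‖f Δ y‖ ^ 2 ≤ ∑ y ∈ R, (2 * ‖(f Δ - g) y‖ ^ 2 + 2 * ‖g y‖ ^ 2) := by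
      refine sum_le_sum fun y _ => ?_
      have e : f Δ y = (f Δ - g) y + g y := by simp
      have := norm_add_le ((f Δ - g) y) (g y)
      rw [← e] at this
      nlinarith [norm_nonneg (f Δ y), sq_nonneg (‖(f Δ - g) y‖ - ‖g y‖)]
    rw [sum_add_distrib, ← mul_sum, ← mul_sum] at h3
    linarith

end Tail

/-! ### Factorization of `A`, and correlations uniform in the boundary condition. -/

section Factor
variable {E : Type u} {H : Type v} [NormedAddCommGroup H] [InnerProductSpace ℂ H]

/-- `A = J* J`, and the family `b` is complete and satisfies `(b x, J f) = f x`. -/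
structure IsFactorization (A : L2 E →L[ℂ] L2 E) (J : L2 E →L[ℂ] H) (b : E → H) : Prop where
  inner_map : ∀ f g, inner ℂ (J f) (J g) = inner ℂ f (A g)
  inner_dual : ∀ x f, inner ℂ (b x) (J f) = f x
  complete : (Submodule.span ℂ (Set.range b)).topologicalClosure = ⊤

/-- The vectors `J e_x`. -/
def factorVec (J : L2 E →L[ℂ] H) (x : E) : H := J (basisVec x)

/-- `J` is the inclusion into the functional completion, bounded because `A` is, and `b x` is the
reproducing kernel at `x`. Kernels are total: a function orthogonal to all of them vanishes at every
point. -/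
lemma HypH.exists_factorization {A : L2 E →L[ℂ] L2 E} (hA : HypH A) :
    ∃ (H : Type u) (_ : NormedAddCommGroup H) (_ : InnerProductSpace ℂ H) (_ : CompleteSpace H)
      (J : L2 E →L[ℂ] H) (b : E → H), IsFactorization A J b := by
  obtain ⟨H, i1, i2, i3, i4, J, h1, h2, -⟩ := hA.functionallyCompleted
  have hb : ∀ f, ‖J f‖ ≤ Real.sqrt ‖A‖ * ‖f‖ := by
    intro f
    refine (sq_le_sq₀ (norm_nonneg _) (by positivity)).1 ?_
    rw [mul_pow, Real.sq_sqrt (norm_nonneg _), ← inner_self_eq_norm_sq (𝕜 := ℂ), h2]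
    calc RCLike.re (inner ℂ f (A f)) ≤ ‖f‖ * ‖A f‖ := re_inner_le_norm _ _
      _ ≤ ‖f‖ * (‖A‖ * ‖f‖) := by gcongr; exact A.le_opNorm f
      _ = _ := by ring
  refine ⟨H, i1, i2, i3, J.mkContinuous _ hb, fun x => RKHS.kerFun H x 1, h2, ?_, ?_⟩
  · intro x f
    simp [h1]
  · refine top_unique ((RKHS.kerFun_dense (𝕜 := ℂ) H).ge.trans (Submodule.topologicalClosure_mono ?_))
    rw [Submodule.span_le]
    rintro _ ⟨x, v, rfl⟩
    have : RKHS.kerFun H x v = v • RKHS.kerFun H x (1 : ℂ) := by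
      rw [← map_smul]; simp
    rw [this]
    exact Submodule.smul_mem _ _ (Submodule.subset_span ⟨x, rfl⟩)

variable {A : L2 E →L[ℂ] L2 E} {J : L2 E →L[ℂ] H} {b : E → H}

lemma IsFactorization.biorthogonal (h : IsFactorization A J b) :
    Biorthogonal b (factorVec J) := by
  intro x y
  rw [factorVec, h.inner_dual, basisVec_apply]
  simp [eq_comm]

lemma IsFactorization.gram_eq (h : IsFactorization A J b) :
    gram ℂ (factorVec J) = Matrix.of (matElem A) := by
  ext x y
  exact h.inner_map _ _

/-- The projections `Q_S`, `S` disjoint from `Λ`, converge to the identity as `Λ` increases. -/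
lemma IsFactorization.orthPart_approx (h : IsFactorization A J b) (v : H) {ε : ℝ} (hε : 0 < ε) :
    ∃ Λ₀ : Finset E, ∀ S, Disjoint Λ₀ S → ‖v - orthPart (factorVec J) S v‖ ≤ ε := by
  have hv : v ∈ (Submodule.span ℂ (Set.range b)).topologicalClosure := by simp [h.complete]
  have hv' : v ∈ closure ((Submodule.span ℂ (Set.range b) : Submodule ℂ H) : Set H) := hv
  obtain ⟨w, hw, hvw⟩ := Metric.mem_closure_iff.1 hv' (ε / 2) (by positivity)
  -- A finite combination of the `b x` is orthogonal to `a y` for all but finitely many `y`, hence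
  -- fixed by the projection once `S` avoids those `y`.
  have key : ∃ Λ₀ : Finset E, ∀ S, Disjoint Λ₀ S → orthPart (factorVec J) S w = w := by
    have hw' : w ∈ Submodule.span ℂ (Set.range b) := hw
    have : ∃ Λ₀ : Finset E, ∀ y, y ∉ Λ₀ → inner ℂ (factorVec J y) w = 0 := by
      clear hvw hw
      induction hw' using Submodule.span_induction with
      | mem u hu =>
        obtain ⟨x, rfl⟩ := hu
        refine ⟨{x}, fun y hy => ?_⟩
        rw [← inner_conj_symm, h.biorthogonal, if_neg, map_zero]
        rintro rfl; simp at hy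
      | zero => exact ⟨∅, by simp⟩
      | add u v _ _ hu hv =>
        obtain ⟨Λ₁, h1⟩ := hu
        obtain ⟨Λ₂, h2⟩ := hv
        refine ⟨Λ₁ ∪ Λ₂, fun y hy => ?_⟩
        rw [inner_add_right, h1 y (by simp_all), h2 y (by simp_all), add_zero]
      | smul c u _ hu =>
        obtain ⟨Λ₁, h1⟩ := hu
        exact ⟨Λ₁, fun y hy => by rw [inner_smul_right, h1 y hy, mul_zero]⟩
    obtain ⟨Λ₀, h0⟩ := this
    exact ⟨Λ₀, fun S hS => orthPart_of_inner_eq_zero fun y hy => h0 y (disjoint_right.1 hS hy)⟩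
  obtain ⟨Λ₀, h0⟩ := key
  refine ⟨Λ₀, fun S hS => ?_⟩
  have e : v - orthPart (factorVec J) S v = (v - w) - orthPart (factorVec J) S (v - w) := by
    rw [orthPart_sub, h0 S hS]; abel
  rw [dist_eq_norm] at hvw
  rw [e]
  calc _ ≤ ‖v - w‖ + ‖orthPart (factorVec J) S (v - w)‖ := norm_sub_le _ _
    _ ≤ ‖v - w‖ + ‖v - w‖ := by gcongr; exact norm_orthPart_le _ _ _
    _ ≤ ε := by linarith

/-- Index pairs `(Λ, S)` with `Λ` large and `S` disjoint from `Λ`. -/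
def boundaryFilter (E : Type u) : Filter (Finset E × Finset E) :=
  comap Prod.fst atTop ⊓ 𝓟 {p | Disjoint p.1 p.2}

/-- Limits along this filter are limits in `Λ`, uniform over all boundary sets `S` disjoint from
`Λ`; uniqueness rests on this uniformity. -/
lemma eventually_boundaryFilter {p : Finset E × Finset E → Prop} :
    (∀ᶠ i in boundaryFilter E, p i) ↔
      ∃ Λ₀ : Finset E, ∀ Λ, Λ₀ ⊆ Λ → ∀ S, Disjoint Λ S → p (Λ, S) := by
  rw [boundaryFilter, eventually_inf_principal, eventually_comap, eventually_atTop]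
  constructor
  · rintro ⟨Λ₀, h⟩
    exact ⟨Λ₀, fun Λ hΛ S hS => h Λ hΛ (Λ, S) rfl hS⟩
  · rintro ⟨Λ₀, h⟩
    refine ⟨Λ₀, fun Λ hΛ i hi hd => ?_⟩
    subst hi
    exact h _ hΛ _ hd

lemma tendsto_fst_boundaryFilter : Tendsto Prod.fst (boundaryFilter E) atTop :=
  tendsto_comap.mono_left inf_le_left

lemma IsFactorization.tendsto_orthPart (h : IsFactorization A J b) (v : H) :
    Tendsto (fun i : Finset E × Finset E => orthPart (factorVec J) i.2 v) (boundaryFilter E)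
      (𝓝 v) := by
  rw [Metric.tendsto_nhds]
  intro ε hε
  rw [eventually_boundaryFilter]
  obtain ⟨Λ₀, h0⟩ := h.orthPart_approx v (half_pos hε)
  refine ⟨Λ₀, fun Λ hΛ S hS => ?_⟩
  rw [dist_comm, dist_eq_norm]
  exact (h0 S (disjoint_of_subset_left hΛ hS)).trans_lt (half_lt_self hε)

/-- Galerkin estimate for solutions of `(1 + J* Q J) n = e` on the finite set `Λ`. -/
lemma galerkin_bound (h : IsFactorization A J b) {Λ S : Finset E} {u : L2 E} {n : E → ℂ}
    {e : E → ℂ} (hu : ∀ x ∈ Λ, u x + (A u) x = e x)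
    (hn : ∀ x ∈ Λ, n x + ∑ y ∈ Λ, inner ℂ (orthPart (factorVec J) S (factorVec J x))
      (orthPart (factorVec J) S (factorVec J y)) * n y = e x) {x : E} (hx : x ∈ Λ) :
    ‖n x - u x‖ ≤ ‖J‖ * ‖J u - orthPart (factorVec J) S (J (trunc Λ u))‖ := by
  set a := factorVec J with ha
  set Q : H →L[ℂ] H := ContinuousLinearMap.id ℂ H - (spanOn a S).starProjection with hQdef
  have hQ : ∀ v, orthPart a S v = Q v := fun v => rfl
  have hQs : ∀ v w, inner ℂ (Q v) (Q w) = inner ℂ v (Q w) := inner_orthPart_left a S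
  have hcomb : ∀ (c : E → ℂ) (w : H), inner ℂ w (Q (J (∑ y ∈ Λ, c y • basisVec y))) =
      ∑ y ∈ Λ, inner ℂ w (Q (a y)) * c y := by
    intro c w
    simp only [map_sum, map_smul, inner_sum, inner_smul_right]
    exact sum_congr rfl fun y _ => mul_comm _ _
  set d : L2 E := ∑ y ∈ Λ, (n y - u y) • basisVec y with hd
  have hdx : ∀ x ∈ Λ, d x = n x - u x := by
    intro x hx
    rw [← inner_basisVec_left, hd, inner_sum]
    simp only [inner_smul_right, inner_basisVec_left, basisVec_apply]
    simp [hx]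
  set v : H := J u - Q (J (trunc Λ u)) with hv
  -- Subtracting the equations for `n` and `u` shows that the error `d`, supported in `Λ`, solves
  -- the same finite system with the residual `v` as source.
  have heq : ∀ x ∈ Λ, d x + inner ℂ (a x) (Q (J d)) = inner ℂ (a x) v := by
    intro x hx
    have h1 := hn x hx
    rw [← hu x hx] at h1
    have h2 : (A u) x = inner ℂ (a x) (J u) := by
      rw [ha, factorVec, h.inner_map, inner_basisVec_left]
    simp only [hQ, hQs] at h1
    rw [h2] at h1
    rw [hdx x hx, hd, hcomb, hv, inner_sub_right, trunc, hcomb]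
    simp only [mul_sub, sum_sub_distrib]
    linear_combination h1
  have hJd : ∀ w : H, inner ℂ (J d) w = ∑ x ∈ Λ, (starRingEnd ℂ) (d x) * inner ℂ (a x) w := by
    intro w
    conv_lhs => rw [hd]
    simp only [map_sum, map_smul, sum_inner, inner_smul_left]
    exact sum_congr rfl fun y hy => by rw [hdx y hy]; rfl
  have hdd : inner ℂ d d = ∑ x ∈ Λ, (starRingEnd ℂ) (d x) * d x := by
    conv_lhs => enter [2]; rw [hd]
    simp only [sum_inner, inner_smul_left, inner_basisVec_left]
    exact sum_congr rfl fun y hy => by rw [hdx y hy]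
  -- Pairing the error equation with `d` is the coercivity step: both terms on the left are
  -- nonnegative.
  have hsum : inner ℂ d d + inner ℂ (Q (J d)) (Q (J d)) = inner ℂ (J d) v := by
    rw [hQs, hJd, hJd, hdd, ← sum_add_distrib]
    exact sum_congr rfl fun y hy => by rw [← mul_add, heq y hy]
  have hre := congrArg (RCLike.re : ℂ → ℝ) hsum
  rw [map_add, inner_self_eq_norm_sq (𝕜 := ℂ), inner_self_eq_norm_sq (𝕜 := ℂ)] at hre
  have h3 : ‖d‖ * ‖d‖ ≤ ‖J‖ * ‖v‖ * ‖d‖ := by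
    calc ‖d‖ * ‖d‖ ≤ RCLike.re (inner ℂ (J d) v) := by
          rw [← hre]; nlinarith [sq_nonneg ‖Q (J d)‖]
      _ ≤ ‖J d‖ * ‖v‖ := re_inner_le_norm _ _
      _ ≤ ‖J‖ * ‖d‖ * ‖v‖ := by gcongr; exact J.le_opNorm d
      _ = _ := by ring
  have h4 : ‖d‖ ≤ ‖J‖ * ‖v‖ := by
    rcases (norm_nonneg d).eq_or_lt with h0 | h0
    · rw [← h0]; positivity
    · exact le_of_mul_le_mul_right h3 h0
  rw [← hdx x hx]
  exact (lp.norm_apply_le_norm (by norm_num) d x).trans h4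

lemma isUnit_one_add_of_isPositive (hA : A.IsPositive) : IsUnit (1 + A) := by
  have h0 : 0 ≤ A := (ContinuousLinearMap.nonneg_iff_isPositive A).2 hA
  exact CStarAlgebra.isUnit_of_le 1 (le_add_of_nonneg_right h0)

lemma matElem_dppOperator (hA : A.IsPositive) (x y : E) :
    matElem (dppOperator A) x y =
      (if x = y then 1 else 0) - (Ring.inverse (1 + A) (basisVec y)) x := by
  have h := Ring.mul_inverse_cancel _ (isUnit_one_add_of_isPositive hA)
  have h' : dppOperator A = 1 - Ring.inverse (1 + A) := by
    rw [dppOperator, eq_sub_iff_add_eq]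
    nth_rewrite 2 [← one_mul (Ring.inverse (1 + A))]
    rw [← add_mul, add_comm A 1, h]
  rw [matElem, h', inner_basisVec_left]
  simp [basisVec_apply, eq_comm]

lemma one_add_inverse_apply (hA : A.IsPositive) (x y : E) :
    (Ring.inverse (1 + A) (basisVec y)) x + (A (Ring.inverse (1 + A) (basisVec y))) x =
      if x = y then 1 else 0 := by
  have h := Ring.mul_inverse_cancel _ (isUnit_one_add_of_isPositive hA)
  have h' := congrArg (fun T : L2 E →L[ℂ] L2 E => (T (basisVec y)) x) h
  simpa [basisVec_apply, eq_comm] using h'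

/-- The correlation function of the `L`-ensemble on `Λ` with boundary condition `S`. -/
def correlation (a : E → H) (X Λ S : Finset E) : ℝ :=
  (∑ ζ ∈ Λ.powerset with X ⊆ ζ, gramDet a (ζ ∪ S)) / ∑ ζ ∈ Λ.powerset, gramDet a (ζ ∪ S)

/-- Identity plus a Gram matrix is positive definite, hence invertible on `Λ`; the inverse is
extended by zero. -/
lemma exists_resolvent (a : E → H) (Λ : Finset E) :
    ∃ N : Matrix E E ℂ, ∀ i ∈ Λ, ∀ k ∈ Λ,
      ∑ j ∈ Λ, (1 + gram ℂ a) i j * N j k = if i = k then 1 else 0 := by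
  set M := (1 + gram ℂ a).submatrix (Subtype.val : Λ → E) (Subtype.val : Λ → E) with hM
  have hpos : M.PosDef := by
    have : M = 1 + gram ℂ fun x : Λ => a x := by
      ext i j
      simp [hM, Matrix.one_apply]
    rw [this]
    exact PosDef.one.add_posSemidef (posSemidef_gram ℂ _)
  have hu : IsUnit M.det := hpos.det_pos.ne'.isUnit
  refine ⟨Matrix.of fun i j => if h : i ∈ Λ ∧ j ∈ Λ then M⁻¹ ⟨i, h.1⟩ ⟨j, h.2⟩ else 0, ?_⟩
  intro i hi k hk
  have h1 := congrFun (congrFun (mul_nonsing_inv M hu) ⟨i, hi⟩) ⟨k, hk⟩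
  rw [mul_apply, Matrix.one_apply] at h1
  simp only [Subtype.mk.injEq] at h1
  rw [← h1, ← sum_coe_sort Λ]
  refine sum_congr rfl fun j _ => ?_
  simp [hM, hk]

/-- By the Schur complement, the ensemble with boundary `S` is the L-ensemble of the projected
vectors. Its correlations are minors of `1 - N`, and `galerkin_bound` gives convergence of the
entries of `N` to those of `(1 + A)⁻¹`, while `K = 1 - (1 + A)⁻¹`. -/
lemma IsFactorization.tendsto_correlation (h : IsFactorization A J b) (hA : A.IsPositive)
    (X : Finset E) :
    Tendsto (fun i : Finset E × Finset E => (correlation (factorVec J) X i.1 i.2 : ℂ))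
      (boundaryFilter E) (𝓝 (subDet (dppOperator A) X)) := by
  set a := factorVec J with ha
  have hex : ∀ i : Finset E × Finset E, _ :=
    fun i => exists_resolvent (fun x => orthPart a i.2 (a x)) i.1
  choose N hN using hex
  have hentry : ∀ x y, Tendsto (fun i => N i x y) (boundaryFilter E)
      (𝓝 ((Ring.inverse (1 + A) (basisVec y)) x)) := by
    intro x y
    set u := Ring.inverse (1 + A) (basisVec y) with hu
    have hlim : Tendsto (fun i : Finset E × Finset E => ‖J‖ * ‖J u - orthPart a i.2 (J (trunc i.1 u))‖)
        (boundaryFilter E) (𝓝 0) := by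
      have h1 : Tendsto (fun i : Finset E × Finset E => ‖J u - orthPart a i.2 (J u)‖ +
          ‖J (u - trunc i.1 u)‖) (boundaryFilter E) (𝓝 (‖J u - J u‖ + ‖J (u - u)‖)) :=
        (tendsto_const_nhds.sub (h.tendsto_orthPart (J u))).norm.add
          ((J.continuous.tendsto _).comp (tendsto_const_nhds.sub
            ((tendsto_trunc u).comp tendsto_fst_boundaryFilter))).norm
      simp only [sub_self, map_zero, norm_zero, add_zero] at h1
      have h2 := h1.const_mul ‖J‖
      rw [mul_zero] at h2
      refine squeeze_zero (fun i => by positivity) (fun i => ?_) h2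
      gcongr
      have e : J u - orthPart a i.2 (J (trunc i.1 u)) =
          (J u - orthPart a i.2 (J u)) + orthPart a i.2 (J (u - trunc i.1 u)) := by
        rw [map_sub, orthPart_sub]; abel
      rw [e]
      refine (norm_add_le _ _).trans ?_
      gcongr
      exact norm_orthPart_le _ _ _
    rw [tendsto_iff_norm_sub_tendsto_zero]
    refine squeeze_zero' (Eventually.of_forall fun _ => norm_nonneg _) ?_ hlim
    rw [eventually_boundaryFilter]
    refine ⟨{x, y}, fun Λ hΛ S _ => ?_⟩
    have hx : x ∈ Λ := hΛ (by simp)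
    have hy : y ∈ Λ := hΛ (by simp)
    refine galerkin_bound h (n := fun x => N (Λ, S) x y) (e := fun x => if x = y then 1 else 0)
      (fun x _ => one_add_inverse_apply hA x y) (fun x hx => ?_) hx
    rw [← hN (Λ, S) x hx y hy]
    simp only [Matrix.add_apply, gram_apply, add_mul, sum_add_distrib]
    congr 1
    simp [Matrix.one_apply, hx]
  have hdet : Tendsto (fun i => minor (1 - N i) X) (boundaryFilter E)
      (𝓝 (subDet (dppOperator A) X)) := by
    rw [subDet_eq_minor]
    unfold minor
    have hc : Continuous fun M : Matrix X X ℂ => M.det := continuous_id.matrix_det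
    refine (hc.tendsto _).comp ?_
    refine tendsto_pi_nhds.2 fun x => tendsto_pi_nhds.2 fun y => ?_
    simp only [submatrix_apply, of_apply, Matrix.sub_apply, matElem_dppOperator hA]
    exact tendsto_const_nhds.sub (hentry x y)
  refine hdet.congr' ?_
  rw [EventuallyEq, eventually_boundaryFilter]
  refine ⟨X, fun Λ hX S hS => ?_⟩
  have hcor := sum_minor_superset (L := gram ℂ fun x => orthPart a S (a x)) hX (hN (Λ, S))
  simp only [← ofReal_gramDet] at hcor
  rw [← Complex.ofReal_sum, ← Complex.ofReal_sum] at hcor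
  have hun : ∀ ζ ∈ Λ.powerset, gramDet a (ζ ∪ S) =
      gramDet (fun x => orthPart a S (a x)) ζ * gramDet a S := fun ζ hζ =>
    gramDet_union a (disjoint_of_subset_left (mem_powerset.1 hζ) hS)
  have hS0 := h.biorthogonal.gramDet_pos S
  have hZ : 0 < ∑ ζ ∈ Λ.powerset, gramDet (fun x => orthPart a S (a x)) ζ := by
    refine sum_pos' (fun _ _ => gramDet_nonneg _ _) ⟨∅, by simp, ?_⟩
    rw [gramDet_empty]; exact one_pos
  rw [correlation, sum_congr rfl hun, sum_congr rfl fun ζ hζ => hun ζ (mem_filter.1 hζ).1,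
    ← sum_mul, ← sum_mul, mul_div_mul_right _ _ hS0.ne', Complex.ofReal_div, hcor,
    mul_div_cancel_left₀ _ (by exact_mod_cast hZ.ne')]

end Factor
end
end DPPGibbs

namespace DPPGibbs
open Classical Finset Filter Topology MeasureTheory
universe u v
noncomputable section

/-! ### Local events on configuration space and compactness of probability measures. -/

section Config
variable {E : Type u}

/-- The restriction of a configuration to the finite set `Δ`. -/
def res (Δ : Finset E) (ξ : Set E) : Finset E := Δ.filter (· ∈ ξ)

lemma mem_res {Δ : Finset E} {ξ : Set E} {x : E} : x ∈ res Δ ξ ↔ x ∈ Δ ∧ x ∈ ξ := mem_filter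

lemma res_subset (Δ : Finset E) (ξ : Set E) : res Δ ξ ⊆ Δ := filter_subset _ _

lemma res_eq_self_iff {X : Finset E} {ξ : Set E} : res X ξ = X ↔ (X : Set E) ⊆ ξ := by
  rw [res, filter_eq_self]; rfl

lemma measurableSet_mem (x : E) : MeasurableSet {ξ : Set E | x ∈ ξ} :=
  measurableSet_setOfPred.2 (measurable_set_mem x)

lemma measurableSet_res (Δ S : Finset E) : MeasurableSet {ξ : Set E | res Δ ξ = S} := by
  have : {ξ : Set E | res Δ ξ = S} =
      if S ⊆ Δ then ⋂ x ∈ Δ, {ξ : Set E | x ∈ ξ ↔ x ∈ S} else ∅ := by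
    ext ξ
    split_ifs with h
    · simp only [Set.mem_ofPred_eq, Set.mem_iInter, Finset.ext_iff, mem_res]
      exact ⟨fun H x hx => by simp [← H, hx], fun H x => ⟨fun hx => (H x hx.1).1 hx.2,
        fun hx => ⟨h hx, (H x (h hx)).2 hx⟩⟩⟩
    · simp only [Set.mem_ofPred_eq, Set.mem_empty_iff_false, iff_false]
      rintro rfl
      exact h (res_subset _ _)
  rw [this]
  split_ifs
  · refine Finset.measurableSet_biInter _ fun x _ => ?_
    by_cases hx : x ∈ S
    · simpa [hx] using measurableSet_mem x
    · have : {ξ : Set E | x ∈ ξ ↔ x ∈ S} = {ξ : Set E | x ∈ ξ}ᶜ := by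
        ext ξ; simp [hx]
      rw [this]
      exact (measurableSet_mem x).compl
  · exact MeasurableSet.empty

lemma measurableSet_superset (X : Finset E) : MeasurableSet {ξ : Set E | (X : Set E) ⊆ ξ} := by
  simp_rw [← res_eq_self_iff]
  exact measurableSet_res X X

lemma measurable_comp_res [Countable E] {β : Type*} [MeasurableSpace β] (Δ : Finset E)
    (F : Finset E → β) : Measurable fun ξ => F (res Δ ξ) := by
  let _ : MeasurableSpace (Finset E) := ⊤
  have h : Measurable (res Δ : Set E → Finset E) :=
    measurable_to_countable' fun S => measurableSet_res Δ S
  exact (measurable_from_top (f := F)).comp h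

/-- The events `X ⊆ ξ` form a π-system, since intersections correspond to unions of the `X`, and
singletons already generate the σ-algebra. -/
lemma ext_of_superset {μ ν : Measure (Set E)} [IsProbabilityMeasure μ] [IsProbabilityMeasure ν]
    (h : ∀ X : Finset E, μ.real {ξ | (X : Set E) ⊆ ξ} = ν.real {ξ | (X : Set E) ⊆ ξ}) :
    μ = ν := by
  set C : Set (Set (Set E)) := Set.range fun X : Finset E => {ξ : Set E | (X : Set E) ⊆ ξ}
  refine ext_of_generate_finite C (le_antisymm ?_ ?_) ?_ ?_ (by simp)
  · have : @Measurable _ _ (MeasurableSpace.generateFrom C) _ (id : Set E → Set E) := by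
      refine (@measurable_set_iff _ _ (MeasurableSpace.generateFrom C) _).2 fun x => ?_
      refine (@measurableSet_setOfPred _ (MeasurableSpace.generateFrom C) _).1 ?_
      refine MeasurableSpace.measurableSet_generateFrom ⟨{x}, ?_⟩
      simp
    exact fun s hs => this hs
  · refine MeasurableSpace.generateFrom_le ?_
    rintro _ ⟨X, rfl⟩
    exact measurableSet_superset X
  · rintro _ ⟨X, rfl⟩ _ ⟨Y, rfl⟩ -
    refine ⟨X ∪ Y, ?_⟩
    ext ξ
    simp
  · rintro _ ⟨X, rfl⟩
    have := h X
    rwa [measureReal_def, measureReal_def, ENNReal.toReal_eq_toReal_iff' (by simp) (by simp)] at this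

lemma sum_measureReal_inter_res (μ : Measure (Set E)) [IsProbabilityMeasure μ] (Λ : Finset E)
    {B : Set (Set E)} (hB : MeasurableSet B) :
    ∑ ζ ∈ Λ.powerset, μ.real (B ∩ {ξ | res Λ ξ = ζ}) = μ.real B := by
  rw [← measureReal_biUnion_finset]
  · congr 1
    ext ξ
    simp [res_subset]
  · intro ζ _ ζ' _ hne
    refine Set.disjoint_left.2 fun ξ h h' => hne ?_
    exact h.2.symm.trans h'.2
  · exact fun ζ _ => hB.inter (measurableSet_res Λ ζ)

lemma integral_comp_res [Countable E] (μ : Measure (Set E)) [IsProbabilityMeasure μ] (Δ : Finset E)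
    (F : Finset E → ℝ) :
    ∫ ξ, F (res Δ ξ) ∂μ = ∑ S ∈ Δ.powerset, F S * μ.real {ξ | res Δ ξ = S} := by
  have h : ∀ ξ, F (res Δ ξ) =
      ∑ S ∈ Δ.powerset, F S * ({ξ | res Δ ξ = S} : Set (Set E)).indicator 1 ξ := by
    intro ξ
    rw [sum_eq_single (res Δ ξ)]
    · simp
    · intro S _ hS
      simp [Ne.symm hS]
    · intro hn
      exact absurd (mem_powerset.2 (res_subset _ _)) hn
  simp_rw [h]
  rw [integral_finsetSum]
  · refine sum_congr rfl fun S _ => ?_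
    rw [integral_const_mul, integral_indicator_one (measurableSet_res Δ S)]
  · intro S _
    exact ((integrable_const (1 : ℝ)).indicator (measurableSet_res Δ S)).const_mul _

/-- The configuration of occupied sites. -/
def ofBool (ω : E → Bool) : Set E := {x | ω x = true}

lemma measurable_ofBool : Measurable (ofBool : (E → Bool) → Set E) := by
  refine measurable_set_iff.2 fun x => ?_
  refine measurableSet_setOfPred.1 ?_
  exact (measurable_pi_apply (X := fun _ : E => Bool) x) (MeasurableSet.singleton true)

lemma isClopen_res_ofBool (Δ S : Finset E) : IsClopen {ω : E → Bool | res Δ (ofBool ω) = S} := by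
  have hc : Continuous fun ω : E → Bool => fun x : Δ => ω x := by fun_prop
  have : {ω : E → Bool | res Δ (ofBool ω) = S} =
      (fun ω : E → Bool => fun x : Δ => ω x) ⁻¹'
        {η | (Finset.univ.filter fun x : Δ => η x = true).map (Function.Embedding.subtype _) = S} := by
    ext ω
    simp only [Set.mem_ofPred_eq, Set.mem_preimage]
    have : res Δ (ofBool ω) = (Finset.univ.filter fun x : Δ => ω x = true).map
        (Function.Embedding.subtype _) := by
      ext x
      simp [mem_res, ofBool, and_comm]
    rw [this]
  rw [this]
  exact (isClopen_discrete _).preimage hc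

/-- Probability measures on configurations have cluster points for the convergence of the
probabilities of local events. -/
lemma exists_limit_measure [Countable E] {ι : Type*} (U : Ultrafilter ι) (P : ι → Measure (Set E))
    [∀ i, IsProbabilityMeasure (P i)] :
    ∃ μ : Measure (Set E), IsProbabilityMeasure μ ∧ ∀ Δ S : Finset E,
      Tendsto (fun i => (P i).real {ξ | res Δ ξ = S}) U (𝓝 (μ.real {ξ | res Δ ξ = S})) := by
  let φ : Set E → E → Bool := fun ξ x => decide (x ∈ ξ)
  have hφ : Measurable φ := by
    refine measurable_pi_iff.2 fun x => ?_
    refine measurable_to_bool ?_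
    convert measurableSet_mem x using 1
    ext ξ
    simp [φ]
  have hφres : ∀ Δ ξ, res Δ (ofBool (φ ξ)) = res Δ ξ := by
    intro Δ ξ; ext x; simp [mem_res, ofBool, φ]
  have hint : ∀ (f : CompactlySupportedContinuousMap (E → Bool) ℝ) i,
      Integrable (fun ξ => f (φ ξ)) (P i) := by
    intro f i
    obtain ⟨C, hC⟩ := f.continuous.bounded_above_of_compact_support f.hasCompactSupport
    refine Integrable.of_bound (f.continuous.measurable.comp hφ).aestronglyMeasurable C ?_
    exact Eventually.of_forall fun ξ => hC _
  have hex : ∀ f : CompactlySupportedContinuousMap (E → Bool) ℝ,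
      ∃ l, Tendsto (fun i => ∫ ξ, f (φ ξ) ∂(P i)) U (𝓝 l) := by
    intro f
    obtain ⟨C, hC⟩ := f.continuous.bounded_above_of_compact_support f.hasCompactSupport
    have hmem : ∀ i, ∫ ξ, f (φ ξ) ∂(P i) ∈ Metric.closedBall (0 : ℝ) C := by
      intro i
      rw [mem_closedBall_zero_iff]
      refine (norm_integral_le_of_norm_le_const (Eventually.of_forall fun ξ => hC (φ ξ))).trans ?_
      simp
    obtain ⟨l, -, hl⟩ := (isCompact_closedBall (0 : ℝ) C).ultrafilter_le_nhds
      (U.map fun i => ∫ ξ, f (φ ξ) ∂(P i))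
      (by rw [Ultrafilter.coe_map, le_principal_iff, Filter.mem_map]; exact Eventually.of_forall hmem)
    exact ⟨l, hl⟩
  choose l hl using hex
  let T : CompactlySupportedContinuousMap (E → Bool) ℝ →ₗ[ℝ] ℝ :=
    { toFun := l
      map_add' := fun f g => by
        refine tendsto_nhds_unique (hl _) (((hl f).add (hl g)).congr fun i => ?_)
        rw [← integral_add (hint f i) (hint g i)]; rfl
      map_smul' := fun c f => by
        refine tendsto_nhds_unique (hl _) (((hl f).const_mul c).congr fun i => ?_)
        rw [← integral_const_mul]; rfl }
  -- The ultrafilter limit of the integrals is a positive functional on continuous functions on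
  -- `{0,1}^E`; Riesz representation makes it a measure. Local events are clopen, so their
  -- indicators are admissible test functions.
  let Φ : CompactlySupportedContinuousMap (E → Bool) ℝ →ₚ[ℝ] ℝ := PositiveLinearMap.mk₀ T (by
    intro f hf
    refine ge_of_tendsto (hl f) (Eventually.of_forall fun i => ?_)
    exact integral_nonneg fun ξ => hf (φ ξ))
  let ρ := RealRMK.rieszMeasure Φ
  have hclopen : ∀ C : Set (E → Bool), IsClopen C →
      Tendsto (fun i => (P i).real (φ ⁻¹' C)) U (𝓝 (ρ.real C)) := by
    intro C hC
    let f : CompactlySupportedContinuousMap (E → Bool) ℝ :=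
      ⟨⟨C.indicator 1, (IsClopen.continuous_indicator hC continuous_one)⟩,
        HasCompactSupport.of_compactSpace _⟩
    have h1 : ∫ ω, f ω ∂ρ = l f := RealRMK.integral_rieszMeasure Φ f
    have h2 : ∫ ω, f ω ∂ρ = ρ.real C := integral_indicator_one hC.isOpen.measurableSet
    rw [← h2, h1]
    refine (hl f).congr fun i => ?_
    rw [← integral_indicator_one (hφ hC.isOpen.measurableSet)]
    rfl
  have hρ : IsProbabilityMeasure ρ := by
    have h := hclopen Set.univ isClopen_univ
    simp only [Set.preimage_univ, probReal_univ] at h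
    have := tendsto_nhds_unique h tendsto_const_nhds
    refine ⟨?_⟩
    rw [measureReal_def] at this
    rw [← ENNReal.toReal_eq_one_iff]
    exact this
  refine ⟨ρ.map ofBool, Measure.isProbabilityMeasure_map measurable_ofBool.aemeasurable, ?_⟩
  intro Δ S
  rw [map_measureReal_apply measurable_ofBool (measurableSet_res Δ S)]
  refine (hclopen _ (isClopen_res_ofBool Δ S)).congr fun i => ?_
  congr 1
  ext ξ
  simp [hφres]

end Config
end
end DPPGibbs

namespace DPPGibbs
open Classical Finset Filter Topology MeasureTheory
universe u v
noncomputable section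

/-! ### Finite L-ensembles, their window marginals and their limits. -/

section Ensemble
variable {E : Type u} {H : Type v} [NormedAddCommGroup H] [InnerProductSpace ℂ H]

lemma sum_smul_dirac_apply {Ω ι : Type*} [MeasurableSpace Ω] (s : Finset ι) {w : ι → ℝ}
    (hw : ∀ i ∈ s, 0 ≤ w i) (p : ι → Ω) {B : Set Ω} (hB : MeasurableSet B) :
    (∑ i ∈ s, ENNReal.ofReal (w i) • Measure.dirac (p i)) B =
      ENNReal.ofReal (∑ i ∈ s, if p i ∈ B then w i else 0) := by
  rw [Measure.finsetSum_apply, ENNReal.ofReal_sum_of_nonneg]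
  · refine sum_congr rfl fun i _ => ?_
    rw [Measure.smul_apply, Measure.dirac_apply' _ hB]
    by_cases h : p i ∈ B <;> simp [h]
  · intro i hi
    split_ifs
    · exact hw i hi
    · exact le_rfl

/-- The `L`-ensemble of the Gram matrix of `a` on the finite set `Λ`. -/
def ensemble (a : E → H) (Λ : Finset E) : Measure (Set E) :=
  ∑ ζ ∈ Λ.powerset, ENNReal.ofReal (gramDet a ζ / ∑ ζ' ∈ Λ.powerset, gramDet a ζ') •
    Measure.dirac (ζ : Set E)

lemma sum_gramDet_pos (a : E → H) (Λ : Finset E) : 0 < ∑ ζ ∈ Λ.powerset, gramDet a ζ :=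
  sum_pos' (fun _ _ => gramDet_nonneg _ _) ⟨∅, by simp, by rw [gramDet_empty]; exact one_pos⟩

lemma ensemble_real (a : E → H) (Λ : Finset E) {B : Set (Set E)} (hB : MeasurableSet B) :
    (ensemble a Λ).real B = (∑ ζ ∈ Λ.powerset.filter fun ζ : Finset E => (ζ : Set E) ∈ B, gramDet a ζ) /
      ∑ ζ ∈ Λ.powerset, gramDet a ζ := by
  have hw : ∀ ζ ∈ Λ.powerset, 0 ≤ gramDet a ζ / ∑ ζ' ∈ Λ.powerset, gramDet a ζ' :=
    fun ζ _ => div_nonneg (gramDet_nonneg _ _) (sum_gramDet_pos a Λ).le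
  rw [measureReal_def, ensemble, sum_smul_dirac_apply _ hw _ hB, ENNReal.toReal_ofReal,
    sum_div, sum_filter]
  refine sum_nonneg fun ζ hζ => ?_
  split_ifs
  · exact hw ζ hζ
  · exact le_rfl

instance (a : E → H) (Λ : Finset E) : IsProbabilityMeasure (ensemble a Λ) := by
  have h := ensemble_real a Λ MeasurableSet.univ
  simp only [Set.mem_univ, filter_true, div_self (sum_gramDet_pos a Λ).ne'] at h
  refine ⟨?_⟩
  rw [measureReal_def] at h
  exact (ENNReal.toReal_eq_one_iff _).1 h

lemma ensemble_real_superset (a : E → H) (Λ X : Finset E) :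
    (ensemble a Λ).real {ξ | res X ξ = X} = correlation a X Λ ∅ := by
  rw [ensemble_real a Λ (measurableSet_res X X), correlation]
  simp only [union_empty, Set.mem_ofPred_eq, res_eq_self_iff, coe_subset]

lemma ensemble_real_res (a : E → H) {Λ Δ S : Finset E} (hΔ : Δ ⊆ Λ) (hS : S ⊆ Δ) :
    (ensemble a Λ).real {ξ | res Δ ξ = S} = gramDet (augment a (Λ \ Δ)) (S ∪ (Λ \ Δ)) /
      ∑ ζ ∈ Λ.powerset, gramDet a ζ := by
  have hd : Disjoint Δ (Λ \ Δ) := disjoint_sdiff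
  rw [ensemble_real a Λ (measurableSet_res Δ S),
    ← sum_gramDet_union a (disjoint_of_subset_left hS hd)]
  congr 1
  symm
  refine sum_bij' (fun X _ => S ∪ X) (fun ζ _ => ζ \ Δ) ?_ ?_ ?_ ?_ ?_
  · intro X hX
    simp only [mem_powerset] at hX
    simp only [mem_filter, mem_powerset, Set.mem_ofPred_eq]
    refine ⟨union_subset (hS.trans hΔ) (hX.trans sdiff_subset), ?_⟩
    ext x
    simp only [mem_res, coe_union, Set.mem_union, mem_coe]
    constructor
    · rintro ⟨h1, h2 | h2⟩
      · exact h2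
      · exact absurd h1 (Finset.mem_sdiff.1 (hX h2)).2
    · exact fun h => ⟨hS h, Or.inl h⟩
  · intro ζ hζ
    simp only [mem_filter, mem_powerset] at hζ ⊢
    exact sdiff_subset_sdiff hζ.1 subset_rfl
  · intro X hX
    simp only [mem_powerset] at hX
    ext x
    simp only [Finset.mem_sdiff, mem_union]
    constructor
    · rintro ⟨h1 | h1, h2⟩
      · exact absurd (hS h1) h2
      · exact h1
    · exact fun h => ⟨Or.inr h, (Finset.mem_sdiff.1 (hX h)).2⟩
  · intro ζ hζ
    simp only [mem_filter, Set.mem_ofPred_eq] at hζ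
    ext x
    rw [← hζ.2]
    simp only [Finset.mem_sdiff, mem_union, mem_res, mem_coe]
    tauto
  · intros; rfl

variable {a : E → H}

lemma ensemble_insert_le {Λ Δ S : Finset E} {x : E} (hΔ : Δ ⊆ Λ)
    (hS : insert x S ⊆ Δ) (hx : x ∉ S) :
    (ensemble a Λ).real {ξ | res Δ ξ = insert x S} ≤
      ‖orthPart a S (a x)‖ ^ 2 * (ensemble a Λ).real {ξ | res Δ ξ = S} := by
  have hS' : S ⊆ Δ := (subset_insert _ _).trans hS
  have hxR : x ∉ Λ \ Δ := fun h => (Finset.mem_sdiff.1 h).2 (hS (mem_insert_self _ _))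
  rw [ensemble_real_res a hΔ hS, ensemble_real_res a hΔ hS', ← mul_div_assoc]
  exact div_le_div_of_nonneg_right (gramDet_augment_insert_le hx hxR
    (disjoint_of_subset_left hS' disjoint_sdiff)) (sum_gramDet_pos a Λ).le

/-- The tail bound is required for every `R` disjoint from `Δ`, so `τ` does not depend on `Λ` and
the inequality survives the limit in `Λ`. -/
lemma le_ensemble_insert {Λ Δ S : Finset E} {x : E} (hΔ : Δ ⊆ Λ)
    (hS : insert x S ⊆ Δ) (hx : x ∉ S) {τ : ℝ}
    (hτ : ∀ R, Disjoint Δ R → ∑ y ∈ R, ‖inner ℂ (a y) (orthPart a S (a x))‖ ^ 2 ≤ τ) :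
    ‖orthPart a S (a x)‖ ^ 4 * (ensemble a Λ).real {ξ | res Δ ξ = S} ≤
      (ensemble a Λ).real {ξ | res Δ ξ = insert x S} * (‖orthPart a S (a x)‖ ^ 2 + τ) := by
  have hS' : S ⊆ Δ := (subset_insert _ _).trans hS
  have hxR : x ∉ Λ \ Δ := fun h => (Finset.mem_sdiff.1 h).2 (hS (mem_insert_self _ _))
  rw [ensemble_real_res a hΔ hS, ensemble_real_res a hΔ hS', ← mul_div_assoc, div_mul_eq_mul_div]
  refine div_le_div_of_nonneg_right ((le_gramDet_augment_insert hx hxR).trans ?_)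
    (sum_gramDet_pos a Λ).le
  exact mul_le_mul_of_nonneg_left (by linarith [hτ (Λ \ Δ) disjoint_sdiff]) (gramDet_nonneg _ _)

/-- A limit of the `L`-ensembles of the Gram matrix of `a`, as the volume increases to `E`. -/
structure IsEnsembleLimit (a : E → H) (μ : Measure (Set E)) : Prop where
  isProbabilityMeasure : IsProbabilityMeasure μ
  exists_ultrafilter : ∃ U : Ultrafilter (Finset E), ↑U ≤ (atTop : Filter (Finset E)) ∧
    ∀ Δ S : Finset E, Tendsto (fun Λ => (ensemble a Λ).real {ξ | res Δ ξ = S}) U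
      (𝓝 (μ.real {ξ | res Δ ξ = S}))

lemma exists_isEnsembleLimit [Countable E] (a : E → H) :
    ∃ μ : Measure (Set E), IsEnsembleLimit a μ := by
  obtain ⟨μ, h1, h2⟩ := exists_limit_measure (Ultrafilter.of atTop) (ensemble a)
  exact ⟨μ, h1, _, Ultrafilter.of_le _, h2⟩

variable {μ : Measure (Set E)}

lemma IsEnsembleLimit.insert_le (hμ : IsEnsembleLimit a μ)
    {Δ S : Finset E} {x : E} (hS : insert x S ⊆ Δ) (hx : x ∉ S) :
    μ.real {ξ | res Δ ξ = insert x S} ≤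
      ‖orthPart a S (a x)‖ ^ 2 * μ.real {ξ | res Δ ξ = S} := by
  obtain ⟨U, hU, h⟩ := hμ.exists_ultrafilter
  refine le_of_tendsto_of_tendsto (h Δ _) ((h Δ S).const_mul _) (hU ?_)
  filter_upwards [eventually_ge_atTop Δ] with Λ hΛ
  exact ensemble_insert_le hΛ hS hx

lemma IsEnsembleLimit.le_insert (hμ : IsEnsembleLimit a μ)
    {Δ S : Finset E} {x : E} (hS : insert x S ⊆ Δ) (hx : x ∉ S) {τ : ℝ}
    (hτ : ∀ R, Disjoint Δ R → ∑ y ∈ R, ‖inner ℂ (a y) (orthPart a S (a x))‖ ^ 2 ≤ τ) :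
    ‖orthPart a S (a x)‖ ^ 4 * μ.real {ξ | res Δ ξ = S} ≤
      μ.real {ξ | res Δ ξ = insert x S} * (‖orthPart a S (a x)‖ ^ 2 + τ) := by
  obtain ⟨U, hU, h⟩ := hμ.exists_ultrafilter
  refine le_of_tendsto_of_tendsto ((h Δ S).const_mul _) ((h Δ _).mul_const _) (hU ?_)
  filter_upwards [eventually_ge_atTop Δ] with Λ hΛ
  exact le_ensemble_insert hΛ hS hx hτ

end Ensemble

/-! ### Energies and window probabilities: the common limit weight. -/

section Main
variable {E : Type u} {H : Type v} [NormedAddCommGroup H] [InnerProductSpace ℂ H]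
variable {A : L2 E →L[ℂ] L2 E} {J : L2 E →L[ℂ] H} {b : E → H} {μ : Measure (Set E)}

lemma IsFactorization.isDPP (h : IsFactorization A J b) (hA : A.IsPositive)
    (hμ : IsEnsembleLimit (factorVec J) μ) : IsDPP (dppOperator A) μ := by
  refine ⟨hμ.isProbabilityMeasure, fun X => ?_⟩
  obtain ⟨U, hU, hlim⟩ := hμ.exists_ultrafilter
  simp_rw [← res_eq_self_iff]
  have h1 := (Complex.continuous_ofReal.tendsto _).comp (hlim X X)
  -- Empty boundary conditions are a special case of the uniform limit.
  have h2 : Tendsto (fun Λ : Finset E => (Λ, (∅ : Finset E))) U (boundaryFilter E) := by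
    refine Tendsto.mono_left ?_ hU
    rw [boundaryFilter, tendsto_inf, tendsto_comap_iff]
    exact ⟨tendsto_id, tendsto_principal.2 (Eventually.of_forall fun Λ => by simp)⟩
  refine tendsto_nhds_unique h1 (((h.tendsto_correlation hA X).comp h2).congr fun Λ => ?_)
  simp only [Function.comp_apply, ensemble_real_superset]

lemma IsFactorization.localEnergy_eq (h : IsFactorization A J b) (Λ ζ : Finset E) (ξ : Set E)
    (Δ : Finset E) :
    localEnergy (detPotential A) Λ ζ ξ Δ = -Real.log (gramDet (factorVec J)
      (ζ ∪ res (Δ \ Λ) ξ) / gramDet (factorVec J) (res (Δ \ Λ) ξ)) := by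
  have hD : ∀ S, (subDet A S).re = gramDet (factorVec J) S := fun S => by
    rw [subDet_eq_minor, ← h.gram_eq]; rfl
  have hpos := h.biorthogonal.gramDet_pos
  rw [Real.log_div (hpos _).ne' (hpos _).ne']
  simp only [localEnergy, mutualEnergy, detPotential, hD]
  rw [res]
  ring

variable [CompleteSpace H]

/-- Pairings with the `a x` are coordinates of `J* v`, hence square-summable; this supplies the tail
bounds. -/
lemma inner_factorVec (x : E) (v : H) :
    inner ℂ (factorVec J x) v = (ContinuousLinearMap.adjoint J v) x := by
  rw [factorVec, ← ContinuousLinearMap.adjoint_inner_right, inner_basisVec_left]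

/-- If the empty window had probability zero, the upper insertion bound would annihilate every
pattern in `Δ`, contradicting total mass one. The lower bound then propagates positivity from the
empty pattern. -/
lemma IsEnsembleLimit.real_res_pos (hμ : IsEnsembleLimit (factorVec J) μ)
    (hab : Biorthogonal b (factorVec J)) {Δ S : Finset E} (hS : S ⊆ Δ) :
    0 < μ.real {ξ | res Δ ξ = S} := by
  have := hμ.isProbabilityMeasure
  have hempty : 0 < μ.real {ξ | res Δ ξ = ∅} := by
    by_contra h0
    have h0' : μ.real {ξ | res Δ ξ = ∅} = 0 := le_antisymm (not_lt.1 h0) measureReal_nonneg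
    have hall : ∀ S, S ⊆ Δ → μ.real {ξ | res Δ ξ = S} = 0 := by
      intro S
      induction S using Finset.induction_on with
      | empty => exact fun _ => h0'
      | insert x S hx ih =>
        intro hS
        have := hμ.insert_le hS hx
        rw [ih ((subset_insert _ _).trans hS), mul_zero] at this
        exact le_antisymm this measureReal_nonneg
    have h1 := sum_measureReal_inter_res μ Δ MeasurableSet.univ
    simp only [Set.univ_inter, probReal_univ] at h1
    rw [sum_eq_zero fun ζ hζ => hall ζ (mem_powerset.1 hζ)] at h1
    exact zero_ne_one h1
  induction S using Finset.induction_on with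
  | empty => exact hempty
  | insert x S hx ih =>
    have hpos := ih ((subset_insert _ _).trans hS)
    have hq := hab.orthPart_pos hx
    have h := hμ.le_insert hS hx (τ := ‖ContinuousLinearMap.adjoint J
      (orthPart (factorVec J) S (factorVec J x))‖ ^ 2) (fun R _ => by
        simp only [inner_factorVec]
        exact sum_le_hasSum _ (fun _ _ => by positivity) (hasSum_norm_sq _))
    refine pos_of_mul_pos_left (lt_of_lt_of_le ?_ h) (by positivity)
    positivity

/-- Squeeze between the two insertion bounds: convergence of the orthogonal parts carries over to
their images under `J*`, so the tail term tends to zero. -/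
lemma IsEnsembleLimit.tendsto_ratio (hμ : IsEnsembleLimit (factorVec J) μ)
    (hab : Biorthogonal b (factorVec J)) {T : Finset E → Finset E} {x : E}
    (hT : ∀ᶠ Δ in atTop, insert x (T Δ) ⊆ Δ) (hx : ∀ Δ, x ∉ T Δ) {q : H} (hq0 : q ≠ 0)
    (hq : Tendsto (fun Δ => orthPart (factorVec J) (T Δ) (factorVec J x)) atTop (𝓝 q)) :
    Tendsto (fun Δ => μ.real {ξ | res Δ ξ = insert x (T Δ)} / μ.real {ξ | res Δ ξ = T Δ}) atTop
      (𝓝 (‖q‖ ^ 2)) := by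
  obtain ⟨τ, hτ, hτb⟩ := exists_tail_bound
    (((ContinuousLinearMap.adjoint J).continuous.tendsto q).comp hq)
  have hτ0 : ∀ Δ, 0 ≤ τ Δ := fun Δ => by simpa using hτb Δ ∅ (disjoint_empty_right _)
  have hn : Tendsto (fun Δ => ‖orthPart (factorVec J) (T Δ) (factorVec J x)‖ ^ 2) atTop
    (𝓝 (‖q‖ ^ 2)) := hq.norm.pow 2
  have hq2 : ‖q‖ ^ 2 ≠ 0 := by simpa using hq0
  have hlow : Tendsto (fun Δ => ‖orthPart (factorVec J) (T Δ) (factorVec J x)‖ ^ 4 /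
      (‖orthPart (factorVec J) (T Δ) (factorVec J x)‖ ^ 2 + τ Δ)) atTop (𝓝 (‖q‖ ^ 2)) := by
    have := (hq.norm.pow 4).div (hn.add hτ) (by simpa using hq0)
    have e : ‖q‖ ^ 4 / (‖q‖ ^ 2 + 0) = ‖q‖ ^ 2 := by
      rw [add_zero]
      field_simp
    rwa [e] at this
  refine tendsto_of_tendsto_of_tendsto_of_le_of_le' hlow hn ?_ ?_
  · filter_upwards [hT] with Δ hΔ
    have hpos := hμ.real_res_pos hab ((subset_insert _ _).trans hΔ)
    have hα := hab.orthPart_pos (hx Δ)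
    have := hτ0 Δ
    rw [div_le_div_iff₀ (by positivity) hpos]
    refine hμ.le_insert hΔ (hx Δ) fun R hR => ?_
    simp only [inner_factorVec]
    exact hτb Δ R hR
  · filter_upwards [hT] with Δ hΔ
    have hpos := hμ.real_res_pos hab ((subset_insert _ _).trans hΔ)
    rw [div_le_iff₀ hpos]
    exact hμ.insert_le hΔ (hx Δ)

lemma monotone_res_sdiff (Λ : Finset E) (ξ : Set E) : Monotone fun Δ => res (Δ \ Λ) ξ := by
  intro Δ Δ' h x
  simp only [mem_res, Finset.mem_sdiff]
  exact fun hx => ⟨⟨h hx.1.1, hx.1.2⟩, hx.2⟩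

lemma disjoint_res_sdiff {Λ ζ : Finset E} (h : ζ ⊆ Λ) (Δ : Finset E) (ξ : Set E) :
    Disjoint ζ (res (Δ \ Λ) ξ) :=
  disjoint_left.2 fun _ hx hx' => (Finset.mem_sdiff.1 (mem_res.1 hx').1).2 (h hx)

/-- One number `w` serves both as Boltzmann factor and as limiting ratio of window probabilities,
for every `ξ`: `exists_tendsto_ratio` is applied once and used with two choices of `π`. -/
lemma IsFactorization.exists_weight (h : IsFactorization A J b) {Λ ζ : Finset E} (hζ : ζ ⊆ Λ)
    (ξ : Set E) :
    ∃ w : ℝ, 0 < w ∧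
      Tendsto (fun Δ => gramDet (factorVec J) (ζ ∪ res (Δ \ Λ) ξ) /
        gramDet (factorVec J) (res (Δ \ Λ) ξ)) atTop (𝓝 w) ∧
      Tendsto (localEnergy (detPotential A) Λ ζ ξ) atTop (𝓝 (-Real.log w)) ∧
      Real.exp (-energy (detPotential A) Λ ζ ξ) = w ∧
      ∀ μ, IsEnsembleLimit (factorVec J) μ →
        Tendsto (fun Δ => μ.real {η | res Δ η = ζ ∪ res (Δ \ Λ) ξ} /
          μ.real {η | res Δ η = res (Δ \ Λ) ξ}) atTop (𝓝 w) := by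
  have hab := h.biorthogonal
  obtain ⟨w, hw, hlim⟩ := exists_tendsto_ratio hab (monotone_res_sdiff Λ ξ) ζ
    fun Δ => disjoint_res_sdiff hζ Δ ξ
  have hnot : ∀ ζ' ⊆ ζ, ∀ x ∈ ζ, x ∉ ζ' → ∀ Δ, x ∉ ζ' ∪ res (Δ \ Λ) ξ := by
    intro ζ' _ x hx hx' Δ
    rw [mem_union, not_or]
    exact ⟨hx', disjoint_left.1 (disjoint_res_sdiff hζ Δ ξ) hx⟩
  have h1 := hlim (fun _ => gramDet (factorVec J))
    (Eventually.of_forall fun _ _ _ => hab.gramDet_pos _) (by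
      intro ζ' hζ' x hx hx' q _ hq
      simp only [insert_union]
      exact tendsto_gramDet_ratio hab (hnot ζ' hζ' x hx hx') hq)
  have h2 : Tendsto (localEnergy (detPotential A) Λ ζ ξ) atTop (𝓝 (-Real.log w)) := by
    refine ((Real.continuousAt_log hw.ne').tendsto.comp h1).neg.congr fun Δ => ?_
    rw [h.localEnergy_eq]; rfl
  refine ⟨w, hw, h1, h2, ?_, fun μ hμ => ?_⟩
  · rw [energy, h2.limUnder_eq, neg_neg, Real.exp_log hw]
  · have hsub : ∀ Δ, Λ ⊆ Δ → ∀ ζ' ⊆ ζ, ζ' ∪ res (Δ \ Λ) ξ ⊆ Δ := fun Δ hΔ ζ' hζ' =>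
      union_subset (hζ'.trans (hζ.trans hΔ)) ((res_subset _ _).trans sdiff_subset)
    refine hlim (fun Δ S => μ.real {η | res Δ η = S}) ?_ ?_
    · filter_upwards [eventually_ge_atTop Λ] with Δ hΔ ζ' hζ'
      exact hμ.real_res_pos hab (hsub Δ hΔ ζ' hζ')
    · intro ζ' hζ' x hx hx' q hq0 hq
      simp only [insert_union]
      refine hμ.tendsto_ratio hab ?_ (hnot ζ' hζ' x hx hx') hq0 hq
      filter_upwards [eventually_ge_atTop Λ] with Δ hΔ
      rw [← insert_union]
      exact hsub Δ hΔ _ (insert_subset hx hζ')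

end Main
end
end DPPGibbs

namespace DPPGibbs
open Classical Finset Filter Topology MeasureTheory
universe u v
noncomputable section

/-! ### The DLR equations and uniqueness. -/

section Gibbs
variable {E : Type u} {H : Type v} [NormedAddCommGroup H] [InnerProductSpace ℂ H]
variable {A : L2 E →L[ℂ] L2 E} {J : L2 E →L[ℂ] H} {b : E → H} {μ : Measure (Set E)}

lemma partitionFunction_pos (V : Finset E → ℝ) (Λ : Finset E) (ξ : Set E) :
    0 < partitionFunction V Λ ξ :=
  sum_pos (fun _ _ => Real.exp_pos _) ⟨∅, by simp⟩

lemma gibbsWeight_nonneg (V : Finset E → ℝ) (Λ ζ : Finset E) (ξ : Set E) :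
    0 ≤ gibbsWeight V Λ ζ ξ :=
  div_nonneg (Real.exp_pos _).le (partitionFunction_pos V Λ ξ).le

lemma sum_gibbsWeight (V : Finset E → ℝ) (Λ : Finset E) (ξ : Set E) :
    ∑ ζ ∈ Λ.powerset, gibbsWeight V Λ ζ ξ = 1 := by
  simp only [gibbsWeight]
  rw [← sum_div]
  exact div_self (partitionFunction_pos V Λ ξ).ne'

/-- The probability of `{ξ | X ⊆ ξ}` under the specification. -/
def specCorrelation (V : Finset E → ℝ) (X Λ : Finset E) (ξ : Set E) : ℝ :=
  ∑ ζ ∈ Λ.powerset, if (X : Set E) ⊆ (ζ : Set E) ∪ (ξ \ (Λ : Set E)) then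
    gibbsWeight V Λ ζ ξ else 0

lemma specification_apply (V : Finset E → ℝ) (Λ : Finset E) (ξ : Set E) {B : Set (Set E)}
    (hB : MeasurableSet B) :
    specification V Λ ξ B = ENNReal.ofReal (∑ ζ ∈ Λ.powerset,
      if (ζ : Set E) ∪ (ξ \ (Λ : Set E)) ∈ B then gibbsWeight V Λ ζ ξ else 0) :=
  sum_smul_dirac_apply _ (fun ζ _ => gibbsWeight_nonneg V Λ ζ ξ) _ hB

lemma specification_superset (V : Finset E → ℝ) (X Λ : Finset E) (ξ : Set E) :
    specification V Λ ξ {η | (X : Set E) ⊆ η} = ENNReal.ofReal (specCorrelation V X Λ ξ) :=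
  specification_apply V Λ ξ (measurableSet_superset X)

lemma specCorrelation_nonneg (V : Finset E → ℝ) (X Λ : Finset E) (ξ : Set E) :
    0 ≤ specCorrelation V X Λ ξ := by
  refine sum_nonneg fun ζ _ => ?_
  split_ifs
  · exact gibbsWeight_nonneg _ _ _ _
  · exact le_rfl

instance (V : Finset E → ℝ) (Λ : Finset E) (ξ : Set E) :
    IsProbabilityMeasure (specification V Λ ξ) := by
  refine ⟨?_⟩
  rw [specification_apply V Λ ξ MeasurableSet.univ]
  simp only [Set.mem_univ, if_true, sum_gibbsWeight, ENNReal.ofReal_one]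

lemma tendsto_div_sum {ι α : Type*} {l : Filter α} {s : Finset ι} {f : ι → α → ℝ} {c : α → ℝ}
    {w : ι → ℝ} (hc : ∀ᶠ x in l, c x ≠ 0)
    (hf : ∀ i ∈ s, Tendsto (fun x => f i x / c x) l (𝓝 (w i))) (hw : ∑ i ∈ s, w i ≠ 0)
    {i : ι} (hi : i ∈ s) :
    Tendsto (fun x => f i x / ∑ j ∈ s, f j x) l (𝓝 (w i / ∑ j ∈ s, w j)) := by
  refine ((hf i hi).div (tendsto_finsetSum s hf) hw).congr' ?_
  filter_upwards [hc] with x hx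
  simp only [Pi.div_apply]
  rw [← sum_div, div_div_div_cancel_right₀ hx]

variable [CompleteSpace H]

lemma IsFactorization.tendsto_gibbsWeight (h : IsFactorization A J b) {Λ ζ : Finset E}
    (hζ : ζ ⊆ Λ) (ξ : Set E) :
    Tendsto (fun Δ => gramDet (factorVec J) (ζ ∪ res (Δ \ Λ) ξ) /
        ∑ ζ' ∈ Λ.powerset, gramDet (factorVec J) (ζ' ∪ res (Δ \ Λ) ξ)) atTop
      (𝓝 (gibbsWeight (detPotential A) Λ ζ ξ)) := by
  refine tendsto_div_sum (f := fun ζ' Δ => gramDet (factorVec J) (ζ' ∪ res (Δ \ Λ) ξ))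
    (w := fun ζ => Real.exp (-energy (detPotential A) Λ ζ ξ))
    (Eventually.of_forall fun Δ => (h.biorthogonal.gramDet_pos (res (Δ \ Λ) ξ)).ne')
    (fun ζ' hζ' => ?_) (partitionFunction_pos _ Λ ξ).ne' (mem_powerset.2 hζ)
  obtain ⟨w, -, hw, -, he, -⟩ := h.exists_weight (mem_powerset.1 hζ') ξ
  rwa [he]

lemma IsFactorization.tendsto_conditional (h : IsFactorization A J b)
    (hμ : IsEnsembleLimit (factorVec J) μ) {Λ ζ : Finset E} (hζ : ζ ⊆ Λ) (ξ : Set E) :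
    Tendsto (fun Δ => μ.real {η | res Δ η = ζ ∪ res (Δ \ Λ) ξ} /
        ∑ ζ' ∈ Λ.powerset, μ.real {η | res Δ η = ζ' ∪ res (Δ \ Λ) ξ}) atTop
      (𝓝 (gibbsWeight (detPotential A) Λ ζ ξ)) := by
  refine tendsto_div_sum (f := fun ζ' Δ => μ.real {η | res Δ η = ζ' ∪ res (Δ \ Λ) ξ})
    (w := fun ζ => Real.exp (-energy (detPotential A) Λ ζ ξ))
    (c := fun Δ => μ.real {η | res Δ η = res (Δ \ Λ) ξ})
    (Eventually.of_forall fun Δ => (hμ.real_res_pos h.biorthogonal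
      ((res_subset _ _).trans sdiff_subset)).ne')
    (fun ζ' hζ' => ?_) (partitionFunction_pos _ Λ ξ).ne' (mem_powerset.2 hζ)
  obtain ⟨w, -, -, -, he, hw⟩ := h.exists_weight (mem_powerset.1 hζ') ξ
  rw [he]
  exact hw μ hμ

lemma IsFactorization.measurable_gibbsWeight [Countable E] (h : IsFactorization A J b)
    {Λ ζ : Finset E} (hζ : ζ ⊆ Λ) : Measurable (gibbsWeight (detPotential A) Λ ζ) := by
  refine measurable_of_tendsto_metrizable' (atTop : Filter (Finset E))
    (f := fun Δ ξ => gramDet (factorVec J) (ζ ∪ res (Δ \ Λ) ξ) /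
        ∑ ζ' ∈ Λ.powerset, gramDet (factorVec J) (ζ' ∪ res (Δ \ Λ) ξ)) (fun Δ => ?_)
    (tendsto_pi_nhds.2 fun ξ => h.tendsto_gibbsWeight hζ ξ)
  exact measurable_comp_res (Δ \ Λ) fun S => gramDet (factorVec J) (ζ ∪ S) /
    ∑ ζ' ∈ Λ.powerset, gramDet (factorVec J) (ζ' ∪ S)

lemma measurable_modify (Λ ζ : Finset E) :
    Measurable fun ξ : Set E => (ζ : Set E) ∪ (ξ \ (Λ : Set E)) := by
  refine measurable_set_iff.2 fun x => ?_
  by_cases h1 : x ∈ ζ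
  · simp [h1]
  · by_cases h2 : x ∈ Λ
    · simp [h1, h2]
    · simpa [h1, h2] using measurable_set_mem x

lemma IsFactorization.measurable_specification [Countable E] (h : IsFactorization A J b)
    (Λ : Finset E) : Measurable (specification (detPotential A) Λ) := by
  refine Measure.measurable_of_measurable_coe _ fun B hB => ?_
  simp only [specification_apply _ _ _ hB]
  refine ENNReal.measurable_ofReal.comp (Finset.measurable_sum _ fun ζ hζ => ?_)
  exact Measurable.ite (measurable_modify Λ ζ hB)
    (h.measurable_gibbsWeight (mem_powerset.1 hζ)) measurable_const

lemma IsFactorization.measurable_specCorrelation [Countable E] (h : IsFactorization A J b)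
    (X Λ : Finset E) : Measurable (specCorrelation (detPotential A) X Λ) := by
  refine Finset.measurable_sum _ fun ζ hζ => ?_
  exact Measurable.ite (measurable_modify Λ ζ (measurableSet_superset X))
    (h.measurable_gibbsWeight (mem_powerset.1 hζ)) measurable_const

lemma inter_res_eq {Λ Δ ζ T : Finset E} (hΛ : Λ ⊆ Δ) (hζ : ζ ⊆ Λ) (hT : T ⊆ Δ \ Λ) :
    {ξ : Set E | res (Δ \ Λ) ξ = T} ∩ {ξ | res Λ ξ = ζ} = {ξ | res Δ ξ = ζ ∪ T} := by
  ext ξ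
  have hu : res Δ ξ = res Λ ξ ∪ res (Δ \ Λ) ξ := by
    ext x
    simp only [mem_union, mem_res, Finset.mem_sdiff]
    have := @hΛ x
    tauto
  simp only [Set.mem_inter_iff, Set.mem_ofPred_eq]
  constructor
  · rintro ⟨rfl, rfl⟩
    exact hu
  · intro he
    have h1 : ∀ x, x ∈ ξ ∧ x ∈ Δ ↔ x ∈ ζ ∨ x ∈ T := fun x => by
      rw [← mem_union, ← he, mem_res, and_comm]
    constructor
    · ext x
      have := h1 x
      have := @hΛ x
      have := @hζ x
      have h2 := @hT x
      simp only [mem_res, Finset.mem_sdiff] at h2 ⊢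
      tauto
    · ext x
      have := h1 x
      have := @hΛ x
      have := @hζ x
      have h2 := @hT x
      simp only [mem_res, Finset.mem_sdiff] at h2 ⊢
      tauto

/-- The law of total probability, conditioning on the configuration in `Δ \ Λ`. -/
lemma integral_conditional [Countable E] [IsProbabilityMeasure μ]
    (hpos : ∀ Δ S : Finset E, S ⊆ Δ → 0 < μ.real {ξ | res Δ ξ = S}) {Λ Δ X : Finset E}
    (hΛ : Λ ⊆ Δ) (hX : X ⊆ Δ) :
    ∫ ξ, (∑ ζ ∈ Λ.powerset, if X ⊆ ζ ∪ res (Δ \ Λ) ξ then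
      μ.real {η | res Δ η = ζ ∪ res (Δ \ Λ) ξ} /
        ∑ ζ' ∈ Λ.powerset, μ.real {η | res Δ η = ζ' ∪ res (Δ \ Λ) ξ} else 0) ∂μ =
      μ.real {ξ | (X : Set E) ⊆ ξ} := by
  rw [integral_comp_res μ (Δ \ Λ) fun T => ∑ ζ ∈ Λ.powerset, if X ⊆ ζ ∪ T then
      μ.real {η | res Δ η = ζ ∪ T} /
        ∑ ζ' ∈ Λ.powerset, μ.real {η | res Δ η = ζ' ∪ T} else 0,
    ← sum_measureReal_inter_res μ (Δ \ Λ) (measurableSet_superset X)]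
  refine sum_congr rfl fun T hT => ?_
  rw [mem_powerset] at hT
  -- The normalising sum is the probability of the outer pattern `T`, so it cancels against the
  -- weight of `T` in the integral.
  have hM : μ.real {ξ | res (Δ \ Λ) ξ = T} =
      ∑ ζ' ∈ Λ.powerset, μ.real {η | res Δ η = ζ' ∪ T} := by
    rw [← sum_measureReal_inter_res μ Λ (measurableSet_res (Δ \ Λ) T)]
    exact sum_congr rfl fun ζ hζ => by rw [inter_res_eq hΛ (mem_powerset.1 hζ) hT]
  have hM0 : μ.real {ξ | res (Δ \ Λ) ξ = T} ≠ 0 := (hpos _ _ hT).ne'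
  rw [← sum_measureReal_inter_res μ Λ ((measurableSet_superset X).inter
    (measurableSet_res (Δ \ Λ) T)), sum_mul]
  refine sum_congr rfl fun ζ hζ => ?_
  rw [mem_powerset] at hζ
  rw [Set.inter_assoc, inter_res_eq hΛ hζ hT, ← hM]
  have hsub : ∀ ξ : Set E, res Δ ξ = ζ ∪ T → ((X : Set E) ⊆ ξ ↔ X ⊆ ζ ∪ T) := by
    intro ξ hξ
    rw [← hξ]
    constructor
    · exact fun h x hx => mem_res.2 ⟨hX hx, h hx⟩
    · exact fun h x hx => (mem_res.1 (h hx)).2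
  split_ifs with hc
  · rw [div_mul_cancel₀ _ hM0]
    congr 1
    ext ξ
    exact ⟨fun hξ => ⟨(hsub ξ hξ).2 hc, hξ⟩, fun hξ => hξ.2⟩
  · rw [zero_mul]
    symm
    convert measureReal_empty (μ := μ)
    ext ξ
    simp only [Set.mem_inter_iff, Set.mem_ofPred_eq, Set.mem_empty_iff_false, iff_false, not_and]
    exact fun h1 h2 => hc ((hsub ξ h2).1 h1)

lemma subset_union_res_iff {X Λ Δ ζ : Finset E} (hX : X ⊆ Δ) (ξ : Set E) :
    X ⊆ ζ ∪ res (Δ \ Λ) ξ ↔ (X : Set E) ⊆ (ζ : Set E) ∪ (ξ \ (Λ : Set E)) := by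
  refine forall_congr' fun x => ?_
  have := @hX x
  simp only [mem_union, mem_res, Finset.mem_sdiff, mem_coe, Set.mem_union, Set.mem_sdiff]
  tauto

/-- For large `Δ` the finite-window identity `integral_conditional` is exact. Its integrands are
bounded and converge at every `ξ`, so dominated convergence applies. -/
lemma IsFactorization.integral_specCorrelation [Countable E] (h : IsFactorization A J b)
    (hμ : IsEnsembleLimit (factorVec J) μ) (X Λ : Finset E) :
    ∫ ξ, specCorrelation (detPotential A) X Λ ξ ∂μ = μ.real {ξ | (X : Set E) ⊆ ξ} := by
  have := hμ.isProbabilityMeasure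
  set G : Finset E → Set E → ℝ := fun Δ ξ => ∑ ζ ∈ Λ.powerset, if X ⊆ ζ ∪ res (Δ \ Λ) ξ then
      μ.real {η | res Δ η = ζ ∪ res (Δ \ Λ) ξ} /
        ∑ ζ' ∈ Λ.powerset, μ.real {η | res Δ η = ζ' ∪ res (Δ \ Λ) ξ} else 0 with hG
  have hGm : ∀ Δ, Measurable (G Δ) := fun Δ =>
    measurable_comp_res (Δ \ Λ) fun T => ∑ ζ ∈ Λ.powerset, if X ⊆ ζ ∪ T then
      μ.real {η | res Δ η = ζ ∪ T} / ∑ ζ' ∈ Λ.powerset, μ.real {η | res Δ η = ζ' ∪ T} else 0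
  have hGb : ∀ Δ ξ, ‖G Δ ξ‖ ≤ ∑ ζ ∈ Λ.powerset, (1 : ℝ) := by
    intro Δ ξ
    refine norm_sum_le_of_le _ fun ζ hζ => ?_
    split_ifs
    · rw [Real.norm_of_nonneg (by positivity)]
      refine div_le_one_of_le₀ ?_ (by positivity)
      exact single_le_sum (f := fun ζ => μ.real {η | res Δ η = ζ ∪ res (Δ \ Λ) ξ})
        (fun _ _ => measureReal_nonneg) hζ
    · simp
  have hlim : Tendsto (fun Δ => ∫ ξ, G Δ ξ ∂μ) atTop
      (𝓝 (∫ ξ, specCorrelation (detPotential A) X Λ ξ ∂μ)) := by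
    refine tendsto_integral_filter_of_dominated_convergence (fun _ => ∑ ζ ∈ Λ.powerset, (1 : ℝ))
      (Eventually.of_forall fun Δ => (hGm Δ).aestronglyMeasurable)
      (Eventually.of_forall fun Δ => Eventually.of_forall (hGb Δ)) (integrable_const _)
      (Eventually.of_forall fun ξ => ?_)
    refine tendsto_finsetSum _ fun ζ hζ => ?_
    have ht := h.tendsto_conditional hμ (mem_powerset.1 hζ) ξ
    by_cases hc : (X : Set E) ⊆ (ζ : Set E) ∪ (ξ \ (Λ : Set E))
    · rw [if_pos hc]
      refine ht.congr' ?_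
      filter_upwards [eventually_ge_atTop X] with Δ hΔ
      rw [if_pos ((subset_union_res_iff hΔ ξ).2 hc)]
    · rw [if_neg hc]
      refine tendsto_const_nhds.congr' ?_
      filter_upwards [eventually_ge_atTop X] with Δ hΔ
      rw [if_neg (mt (subset_union_res_iff hΔ ξ).1 hc)]
  refine tendsto_nhds_unique hlim (tendsto_const_nhds.congr' ?_)
  filter_upwards [eventually_ge_atTop (Λ ∪ X)] with Δ hΔ
  exact (integral_conditional (fun _ _ => hμ.real_res_pos h.biorthogonal)
    (subset_union_left.trans hΔ) (subset_union_right.trans hΔ)).symm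

/-- Both sides of the DLR equation are probability measures in `B`, so it suffices to compare them
on the events `X ⊆ ξ`. -/
lemma IsFactorization.isGibbs [Countable E] (h : IsFactorization A J b)
    (hμ : IsEnsembleLimit (factorVec J) μ) : IsGibbs (detPotential A) μ := by
  have := hμ.isProbabilityMeasure
  refine ⟨this, fun Λ B hB => ?_⟩
  have hm := h.measurable_specification Λ
  have hp : IsProbabilityMeasure (μ.bind (specification (detPotential A) Λ)) := by
    refine ⟨?_⟩
    rw [Measure.bind_apply MeasurableSet.univ hm.aemeasurable]
    simp
  have heq : μ = μ.bind (specification (detPotential A) Λ) := by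
    refine ext_of_superset fun X => ?_
    rw [measureReal_def (μ.bind _), Measure.bind_apply (measurableSet_superset X) hm.aemeasurable]
    simp only [specification_superset]
    rw [← integral_eq_lintegral_of_nonneg_ae
      (Eventually.of_forall (specCorrelation_nonneg (detPotential A) X Λ))
      (h.measurable_specCorrelation X Λ).aestronglyMeasurable, h.integral_specCorrelation hμ]
  conv_lhs => rw [heq]
  exact Measure.bind_apply hB hm.aemeasurable

/-- Each finite `Δ` provides a boundary set disjoint from `Λ`, to which the uniform estimate
applies; the bound passes to the limit in `Δ`. -/
lemma IsFactorization.specCorrelation_close (h : IsFactorization A J b) (hA : A.IsPositive)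
    (X : Finset E) {ε : ℝ} (hε : 0 < ε) :
    ∃ Λ : Finset E, ∀ ξ, |specCorrelation (detPotential A) X Λ ξ -
      (subDet (dppOperator A) X).re| ≤ ε := by
  have ht : Tendsto (fun i : Finset E × Finset E => correlation (factorVec J) X i.1 i.2)
      (boundaryFilter E) (𝓝 (subDet (dppOperator A) X).re) :=
    (Complex.continuous_re.tendsto _).comp (h.tendsto_correlation hA X)
  have hev := Metric.tendsto_nhds.1 ht ε hε
  rw [eventually_boundaryFilter] at hev
  obtain ⟨Λ₀, h0⟩ := hev
  -- Including `X` in `Λ` makes the event depend only on the configuration inside `Λ`.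
  refine ⟨Λ₀ ∪ X, fun ξ => ?_⟩
  set Λ := Λ₀ ∪ X
  have hX : X ⊆ Λ := subset_union_right
  have hlim : Tendsto (fun Δ => correlation (factorVec J) X Λ (res (Δ \ Λ) ξ)) atTop
      (𝓝 (specCorrelation (detPotential A) X Λ ξ)) := by
    have hs : specCorrelation (detPotential A) X Λ ξ =
        ∑ ζ ∈ Λ.powerset with X ⊆ ζ, gibbsWeight (detPotential A) Λ ζ ξ := by
      rw [sum_filter]
      refine sum_congr rfl fun ζ _ => ?_
      congr 1
      refine propext (forall_congr' fun x => ?_)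
      have := @hX x
      simp only [mem_coe, Set.mem_union, Set.mem_sdiff]
      tauto
    rw [hs]
    simp only [correlation, sum_div]
    exact tendsto_finsetSum _ fun ζ hζ =>
      h.tendsto_gibbsWeight (mem_powerset.1 (mem_filter.1 hζ).1) ξ
  refine le_of_tendsto (hlim.sub_const _).abs (Eventually.of_forall fun Δ => ?_)
  exact (h0 Λ subset_union_left _ (disjoint_res_sdiff subset_rfl Δ ξ)).le

/-- The DLR equation writes the correlation of `ν` as an average of specification correlations, all
within `ε` of the same minor of `K`. -/
lemma IsFactorization.real_superset_of_isGibbs (h : IsFactorization A J b) (hA : A.IsPositive)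
    {ν : Measure (Set E)} (hν : IsGibbs (detPotential A) ν) (X : Finset E) :
    ν.real {ξ | (X : Set E) ⊆ ξ} = (subDet (dppOperator A) X).re := by
  have := hν.1
  set c := (subDet (dppOperator A) X).re
  refine eq_of_abs_sub_le_all fun ε hε => ?_
  obtain ⟨Λ, hΛ⟩ := h.specCorrelation_close hA X hε
  have hD := hν.2 Λ _ (measurableSet_superset X)
  simp only [specification_superset] at hD
  have hup : ν {ξ | (X : Set E) ⊆ ξ} ≤ ENNReal.ofReal (c + ε) := by
    rw [hD]
    calc _ ≤ ∫⁻ _, ENNReal.ofReal (c + ε) ∂ν := lintegral_mono fun ξ =>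
          ENNReal.ofReal_le_ofReal (by linarith [(abs_le.1 (hΛ ξ)).2])
      _ = _ := by simp
  have hlow : ENNReal.ofReal (c - ε) ≤ ν {ξ | (X : Set E) ⊆ ξ} := by
    rw [hD]
    calc _ = ∫⁻ _, ENNReal.ofReal (c - ε) ∂ν := by simp
      _ ≤ _ := lintegral_mono fun ξ =>
          ENNReal.ofReal_le_ofReal (by linarith [(abs_le.1 (hΛ ξ)).1])
  have hc : 0 ≤ c + ε := by
    have := (abs_le.1 (hΛ ∅)).2
    linarith [specCorrelation_nonneg (detPotential A) X Λ ∅]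
  have h1 := ENNReal.toReal_le_of_le_ofReal hc hup
  have h2 := (ENNReal.ofReal_le_iff_le_toReal (by simp)).1 hlow
  rw [abs_le, measureReal_def]
  constructor <;> linarith

end Gibbs
end
end DPPGibbs

theorem theorem2p5 {E : Type*} [Countable E]
    (A : DPPGibbs.L2 E →L[ℂ] DPPGibbs.L2 E) (hA : DPPGibbs.HypH A) :
    DPPGibbs.EnergiesExist (DPPGibbs.detPotential A) ∧
    ∃ μ : MeasureTheory.Measure (Set E),
      (DPPGibbs.IsDPP (DPPGibbs.dppOperator A) μ ∧
        ∀ μ' : MeasureTheory.Measure (Set E),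
          DPPGibbs.IsDPP (DPPGibbs.dppOperator A) μ' → μ' = μ) ∧
      DPPGibbs.IsGibbs (DPPGibbs.detPotential A) μ ∧
      ∀ ν : MeasureTheory.Measure (Set E),
        DPPGibbs.IsGibbs (DPPGibbs.detPotential A) ν → ν = μ := by
  obtain ⟨H, _, _, _, J, b, h⟩ := hA.exists_factorization
  obtain ⟨μ, hμ⟩ := DPPGibbs.exists_isEnsembleLimit (DPPGibbs.factorVec J)
  have hprob := hμ.isProbabilityMeasure
  have hdpp := h.isDPP hA.isPositive hμ
  have hreal : ∀ X : Finset E,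
      μ.real {ξ | (X : Set E) ⊆ ξ} = (DPPGibbs.subDet (DPPGibbs.dppOperator A) X).re :=
    fun X => by rw [← hdpp.2 X, Complex.ofReal_re]
  refine ⟨fun Λ ζ ξ hζ => ?_, μ, ⟨hdpp, fun μ' hμ' => ?_⟩, h.isGibbs hμ, fun ν hν => ?_⟩
  · obtain ⟨w, -, -, hw, -⟩ := h.exists_weight hζ ξ
    exact ⟨_, hw⟩
  · have := hμ'.1
    refine DPPGibbs.ext_of_superset fun X => ?_
    rw [hreal, ← hμ'.2 X, Complex.ofReal_re]
  · have := hν.1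
    refine DPPGibbs.ext_of_superset fun X => ?_
    rw [hreal, h.real_superset_of_isGibbs hA.isPositive hν]
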